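/- Let $k$ be an algebraically closed field. A finite linear category over $k$ is a $k$-linear abelian category with finite-dimensional morphism spaces, enough projectives, finitely many simple objects up to isomorphism and all objects of finite length. Let $\mathcal A$ be a finite linear category with a balanced braided structure in $\mathsf{Lex}^{\mathsf f}$: a braided monoidal structure, with unit $I$ and braiding $c$, whose monoidal product is $k$-bilinear and left exact in each variable, and a natural automorphism $\theta$ of $\mathrm{id}_{\mathcal A}$ with $\theta_I=\mathrm{id}_I$ and $\theta_{X\otimes Y}=c_{Y,X}c_{X,Y}(\theta_X\otimes\theta_Y)$. A *ribbon Grothendieck-Verdier structure* on $\mathcal A$ consists of an object $K$, an equivalence $D:\mathcal A\to\mathcal A^{\mathrm{opp}}$ and linear isomorphisms $\mathcal A(DX,Y)\cong\mathcal A(K,X\otimes Y)$ natural in $X,Y$, such that $\theta_{DX}=D\theta_X$ for all $X$. Write $\kappa(X,Y)=\mathcal A(DX,Y)$ and let $\gamma:\kappa(I,X\otimes Y)\cong\kappa(X,Y)$ be the induced isomorphism. * $B\mathsf{AUT}_{\mathsf fE_2}(\mathcal A)$ is the 2-groupoid with a single object $\star$, whose 1-morphisms are the linear braided monoidal autoequivalences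 $F$ of $\mathcal A$ with $F\theta_X=\theta_{FX}$, and whose 2-morphisms are the monoidal natural isomorphisms. * $\mathsf{RIBGV}(\mathcal A)$ is the 2-groupoid whose objects are the ribbon Grothendieck-Verdier structures on $\mathcal A$, whose 1-morphisms are such autoequivalences $F$ together with natural linear isomorphisms $t_{X,Y}:\kappa(X,Y)\cong\kappa'(FX,FY)$ compatible with $\gamma,\gamma'$ and the monoidal structure of $F$, and whose 2-morphisms are the monoidal natural isomorphisms compatible with the isomorphisms $t$. * $q:\mathsf{RIBGV}(\mathcal A)\to B\mathsf{AUT}_{\mathsf fE_2}(\mathcal A)$ is the forgetful map. * $Z_2^{\mathsf{bal}}(\mathcal A)$, the balanced Müger center, is the full monoidal subcategory of those objects $X$ with $c_{Y,X}c_{X,Y}=\mathrm{id}$ for all $Y\in\mathcal A$ and $\theta_X=\mathrm{id}_X$, and $\mathsf{PIC}(Z_2^{\mathsf{bal}}(\mathcal A))$ is the groupoid of its $\otimes$-invertible objects and isomorphisms between them, seen as a 2-groupoid with only identity 2-morphisms. **Theorem.** Let $\mathcal A$ be equipped with a ribbon Grothendieck-Verdier structure, so that $\mathcal A$ is also an object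 of $\mathsf{RIBGV}(\mathcal A)$. Then $\mathsf{RIBGV}(\mathcal A)$ and $B\mathsf{AUT}_{\mathsf fE_2}(\mathcal A)$ are indeed 2-groupoids, and $q$ is a fibration: given an object $\mathcal D$ of $\mathsf{RIBGV}(\mathcal A)$, every 1-morphism out of $q(\mathcal D)$ lifts to a 1-morphism out of $\mathcal D$; and given composable 1-morphisms $\widetilde\varphi:\mathcal D\to\mathcal E$, $\widetilde\psi:\mathcal E\to\mathcal F$, every 2-isomorphism $q(\widetilde\psi)\,q(\widetilde\varphi)\cong\chi$ lifts to a 2-isomorphism $\widetilde\psi\widetilde\varphi\cong\widetilde\chi$. Moreover, there is an equivalence of 2-groupoids from $\mathsf{PIC}(Z_2^{\mathsf{bal}}(\mathcal A))$ to the homotopy fiber of $q$ over $\star$, that sends $I$ to the object $\mathcal A$ with the identity path. Hence there is a fiber sequence of 2-groupoids $$\mathsf{PIC}(Z_2^{\mathsf{bal}}(\mathcal A))\longrightarrow\mathsf{RIBGV}(\mathcal A)\xrightarrow{\ q\ }B\mathsf{AUT}_{\mathsf fE_2}(\mathcal A)$$ whose first map sends $I$ to $\mathcal A$. -/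

import Mathlib

open CategoryTheory MonoidalCategory BraidedCategory
open scoped CategoryTheory.Bicategory

universe w v u w₁ v₁ u₁ w₂ v₂ u₂

/-! ## 2-groupoids, fibrations, homotopy fibers

2-groupoids are modelled by Mathlib's bicategories, and maps between them by pseudofunctors. -/

namespace TwoGpd

variable {B : Type u₁} [Bicategory.{w₁, v₁} B] {C : Type u₂} [Bicategory.{w₂, v₂} C]

/-- A bicategory is a 2-groupoid if all its 2-morphisms are isomorphisms and all its 1-morphisms
are equivalences. -/
def IsTwoGroupoid (B : Type u₁) [Bicategory.{w₁, v₁} B] : Prop :=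
  (∀ ⦃a b : B⦄ ⦃f g : a ⟶ b⦄ (η : f ⟶ g), IsIso η) ∧
    ∀ ⦃a b : B⦄ (f : a ⟶ b), ∃ e : Bicategory.Equivalence a b, e.hom = f

/-- Equivalences of bicategories: essentially surjective on objects (up to internal equivalence)
and an equivalence on every category of 1-morphisms. -/
def IsBiequivalence (F : B ⥤ᵖ C) : Prop :=
  (∀ c : C, ∃ b : B, Nonempty (Bicategory.Equivalence (F.obj b) c)) ∧
    ∀ a b : B, (F.mapFunctor a b).IsEquivalence

/-- Fibrations of 2-groupoids. The first condition lifts a 1-morphism `φ` out of `F x`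
(a map `Δ¹ → C`) to a 1-morphism with prescribed source `x`. The second one lifts a 2-simplex
`σ : F f ≫ F g ≅ χ` whose horn `x ⟶ y ⟶ z` is already lifted to `f` and `g`.
Lifts are strict; the equalities are equalities of pairs, since the target of the lift is not known
beforehand to lie over the target of the given cell. -/
structure IsFibration (F : B ⥤ᵖ C) : Prop where
  lift_one : ∀ (x : B) (c : C) (φ : F.obj x ⟶ c), ∃ (y : B) (f : x ⟶ y),
    (⟨F.obj y, F.map f⟩ : Σ c' : C, F.obj x ⟶ c') = ⟨c, φ⟩
  lift_two : ∀ (x y z : B) (f : x ⟶ y) (g : y ⟶ z) (χ : F.obj x ⟶ F.obj z)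
    (σ : F.map f ≫ F.map g ≅ χ), ∃ (h : x ⟶ z) (τ : f ≫ g ≅ h),
    (⟨F.map h, (F.mapComp f g).inv ≫ F.map₂ τ.hom⟩ :
      Σ χ' : F.obj x ⟶ F.obj z, F.map f ≫ F.map g ⟶ χ') = ⟨χ, σ.hom⟩

/-- The homotopy fiber of a pseudofunctor `F` over an object `c`: its objects are objects `obj` of
the source together with a 1-morphism (a path) from `c` to `F obj`. It is meant for the case in
which source and target are 2-groupoids. -/
structure HoFiber (F : B ⥤ᵖ C) (c : C) where
  obj : B
  path : c ⟶ F.obj obj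

namespace HoFiber

variable {F : B ⥤ᵖ C} {c : C}

/-- A 1-morphism of the homotopy fiber: a 1-morphism of the source and an invertible 2-morphism
filling the triangle formed by its image and the two paths. -/
structure Hom (x y : HoFiber F c) where
  map : x.obj ⟶ y.obj
  fill : x.path ≫ F.map map ≅ y.path

/-- A 2-morphism of the homotopy fiber: a 2-morphism of the source compatible with the fillings. -/
@[ext]
structure Hom₂ {x y : HoFiber F c} (f g : Hom x y) where
  cell : f.map ⟶ g.map
  w : x.path ◁ F.map₂ cell ≫ g.fill.hom = f.fill.hom

instance categoryStruct : CategoryStruct (HoFiber F c) where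
  Hom x y := Hom x y
  id x := ⟨𝟙 x.obj, Bicategory.whiskerLeftIso x.path (F.mapId x.obj) ≪≫ Bicategory.rightUnitor x.path⟩
  comp {x _ _} f g := ⟨f.map ≫ g.map,
    Bicategory.whiskerLeftIso x.path (F.mapComp f.map g.map) ≪≫
      (Bicategory.associator x.path (F.map f.map) (F.map g.map)).symm ≪≫
      Bicategory.whiskerRightIso f.fill (F.map g.map) ≪≫ g.fill⟩

instance homCategory (x y : HoFiber F c) : Category (x ⟶ y) where
  Hom f g := Hom₂ f g
  id f := ⟨𝟙 (Hom.map f), by simp⟩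
  comp {f g h} a b := ⟨Hom₂.cell a ≫ Hom₂.cell b, by simp [Hom₂.w]⟩
  id_comp _ := Hom₂.ext (Category.id_comp _)
  comp_id _ := Hom₂.ext (Category.comp_id _)
  assoc _ _ _ := Hom₂.ext (Category.assoc _ _ _)

@[ext]
lemma hom₂_ext {x y : HoFiber F c} {f g : x ⟶ y} {a b : f ⟶ g}
    (h : Hom₂.cell a = Hom₂.cell b) : a = b :=
  Hom₂.ext h

/-- Invertible 2-morphisms of the homotopy fiber. -/
@[simps]
def isoMk {x y : HoFiber F c} {f g : x ⟶ y} (e : Hom.map f ≅ Hom.map g)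
    (w : x.path ◁ F.map₂ e.hom ≫ (Hom.fill g).hom = (Hom.fill f).hom) : f ≅ g where
  hom := ⟨e.hom, w⟩
  inv := ⟨e.inv, by
    rw [← w, ← Category.assoc, ← Bicategory.whiskerLeft_comp, ← PrelaxFunctor.map₂_comp]
    simp⟩
  hom_inv_id := Hom₂.ext e.hom_inv_id
  inv_hom_id := Hom₂.ext e.inv_hom_id

@[simp] lemma id_map (x : HoFiber F c) : Hom.map (𝟙 x) = 𝟙 x.obj := rfl

@[simp] lemma comp_map {x y z : HoFiber F c} (f : x ⟶ y) (g : y ⟶ z) :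
    Hom.map (f ≫ g) = Hom.map f ≫ Hom.map g := rfl

lemma id_fill_hom (x : HoFiber F c) :
    (Hom.fill (𝟙 x)).hom = x.path ◁ (F.mapId x.obj).hom ≫ (Bicategory.rightUnitor x.path).hom :=
  rfl

lemma comp_fill_hom {x y z : HoFiber F c} (f : x ⟶ y) (g : y ⟶ z) :
    (Hom.fill (f ≫ g)).hom = x.path ◁ (F.mapComp (Hom.map f) (Hom.map g)).hom ≫
      (Bicategory.associator x.path (F.map (Hom.map f)) (F.map (Hom.map g))).inv ≫
      (Hom.fill f).hom ▷ F.map (Hom.map g) ≫ (Hom.fill g).hom :=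
  rfl

lemma whiskerLeft_w {x y z : HoFiber F c} (f : x ⟶ y) {g h : y ⟶ z} (a : g ⟶ h) :
    x.path ◁ F.map₂ (Hom.map f ◁ Hom₂.cell a) ≫ (Hom.fill (f ≫ h)).hom =
      (Hom.fill (f ≫ g)).hom := by
  simp only [comp_fill_hom, ← Hom₂.w a]
  simp [← Bicategory.whisker_exchange_assoc]

lemma whiskerRight_w {x y z : HoFiber F c} {f g : x ⟶ y} (a : f ⟶ g) (h : y ⟶ z) :
    x.path ◁ F.map₂ (Hom₂.cell a ▷ Hom.map h) ≫ (Hom.fill (g ≫ h)).hom =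
      (Hom.fill (f ≫ h)).hom := by
  simp only [comp_fill_hom, ← Hom₂.w a]
  simp

lemma associator_w {x y z t : HoFiber F c} (f : x ⟶ y) (g : y ⟶ z) (h : z ⟶ t) :
    x.path ◁ F.map₂ (Bicategory.associator (Hom.map f) (Hom.map g) (Hom.map h)).hom ≫
      (Hom.fill (f ≫ g ≫ h)).hom = (Hom.fill ((f ≫ g) ≫ h)).hom := by
  simp only [comp_fill_hom]
  simp only [Pseudofunctor.map₂_associator, Bicategory.whiskerLeft_comp, Category.assoc]
  simp [← Bicategory.whisker_exchange_assoc]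

lemma leftUnitor_w {x y : HoFiber F c} (f : x ⟶ y) :
    x.path ◁ F.map₂ (Bicategory.leftUnitor (Hom.map f)).hom ≫ (Hom.fill f).hom =
      (Hom.fill (𝟙 x ≫ f)).hom := by
  simp only [comp_fill_hom, id_fill_hom]
  simp [Pseudofunctor.map₂_left_unitor]

lemma rightUnitor_w {x y : HoFiber F c} (f : x ⟶ y) :
    x.path ◁ F.map₂ (Bicategory.rightUnitor (Hom.map f)).hom ≫ (Hom.fill f).hom =
      (Hom.fill (f ≫ 𝟙 y)).hom := by
  simp only [comp_fill_hom, id_fill_hom]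
  simp [Pseudofunctor.map₂_right_unitor, ← Bicategory.whisker_exchange_assoc]

instance bicategory : Bicategory (HoFiber F c) where
  whiskerLeft f _ _ a := Hom₂.mk (Hom.map f ◁ Hom₂.cell a) (whiskerLeft_w f a)
  whiskerRight a h := Hom₂.mk (Hom₂.cell a ▷ Hom.map h) (whiskerRight_w a h)
  associator f g h :=
    isoMk (Bicategory.associator (Hom.map f) (Hom.map g) (Hom.map h)) (associator_w f g h)
  leftUnitor f := isoMk (Bicategory.leftUnitor (Hom.map f)) (leftUnitor_w f)
  rightUnitor f := isoMk (Bicategory.rightUnitor (Hom.map f)) (rightUnitor_w f)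
  whisker_exchange a b := Hom₂.ext (Bicategory.whisker_exchange (Hom₂.cell a) (Hom₂.cell b))
  whiskerLeft_id f g := Hom₂.ext (Bicategory.whiskerLeft_id (Hom.map f) (Hom.map g))
  whiskerLeft_comp f _ _ _ a b :=
    Hom₂.ext (Bicategory.whiskerLeft_comp (Hom.map f) (Hom₂.cell a) (Hom₂.cell b))
  id_whiskerLeft a := Hom₂.ext (Bicategory.id_whiskerLeft (Hom₂.cell a))
  comp_whiskerLeft f g _ _ a :=
    Hom₂.ext (Bicategory.comp_whiskerLeft (Hom.map f) (Hom.map g) (Hom₂.cell a))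
  id_whiskerRight f g := Hom₂.ext (Bicategory.id_whiskerRight (Hom.map f) (Hom.map g))
  comp_whiskerRight a b h :=
    Hom₂.ext (Bicategory.comp_whiskerRight (Hom₂.cell a) (Hom₂.cell b) (Hom.map h))
  whiskerRight_id a := Hom₂.ext (Bicategory.whiskerRight_id (Hom₂.cell a))
  whiskerRight_comp a g h :=
    Hom₂.ext (Bicategory.whiskerRight_comp (Hom₂.cell a) (Hom.map g) (Hom.map h))
  whisker_assoc f _ _ a h :=
    Hom₂.ext (Bicategory.whisker_assoc (Hom.map f) (Hom₂.cell a) (Hom.map h))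
  pentagon f g h i :=
    Hom₂.ext (Bicategory.pentagon (Hom.map f) (Hom.map g) (Hom.map h) (Hom.map i))
  triangle f g := Hom₂.ext (Bicategory.triangle (Hom.map f) (Hom.map g))

/-- The projection from the homotopy fiber to the source. -/
def proj (F : B ⥤ᵖ C) (c : C) : HoFiber F c ⥤ᵖ B where
  obj x := x.obj
  map f := Hom.map f
  map₂ a := Hom₂.cell a
  map₂_id _ := rfl
  map₂_comp _ _ := rfl
  mapId _ := Iso.refl _
  mapComp _ _ := Iso.refl _
  map₂_whisker_left f _ _ a := by
    change _ = 𝟙 _ ≫ Hom.map f ◁ Hom₂.cell a ≫ 𝟙 _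
    rw [Category.id_comp, Category.comp_id]; rfl
  map₂_whisker_right a h := by
    change _ = 𝟙 _ ≫ Hom₂.cell a ▷ Hom.map h ≫ 𝟙 _
    rw [Category.id_comp, Category.comp_id]; rfl
  map₂_associator f g h := by
    simp; rfl
  map₂_left_unitor f := by
    simp; rfl
  map₂_right_unitor f := by
    simp; rfl

end HoFiber
end TwoGpd

/-! ## Finite linear categories and balanced braided categories in `Lex^f` -/

/-- A finite linear category over `k`: a linear abelian category with finite-dimensional morphism
spaces, enough projective objects and finitely many simple objects up to isomorphism, such that
every object has finite length (i.e. is both artinian and noetherian). -/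
class FiniteLinearCategory (k : Type w) [Field k] (A : Type u) [Category.{v} A] [Abelian A]
    [Linear k A] : Prop where
  finite_hom : ∀ X Y : A, Module.Finite k (X ⟶ Y)
  finite_length : ∀ X : A, IsArtinianObject X ∧ IsNoetherianObject X
  enough_projectives : EnoughProjectives A
  finite_simple : ∃ (n : ℕ) (S : Fin n → A), ∀ X : A, Simple X → ∃ i, Nonempty (X ≅ S i)

/-- The monoidal product is left exact in each variable. Together with bilinearity this says that
it is a 1-morphism `A ⊠ A ⟶ A` of finite linear categories and left exact functors. -/
class LeftExactTensor (A : Type u) [Category.{v} A] [MonoidalCategory A] : Prop where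
  tensorLeft : ∀ X : A, Limits.PreservesFiniteLimits (MonoidalCategory.tensorLeft X)
  tensorRight : ∀ X : A, Limits.PreservesFiniteLimits (MonoidalCategory.tensorRight X)

/-- A balancing on a braided monoidal category. -/
class Balancing (A : Type u) [Category.{v} A] [MonoidalCategory A] [BraidedCategory A] where
  twistIso : 𝟭 A ≅ 𝟭 A
  twist_unit : twistIso.hom.app (𝟙_ A) = 𝟙 (𝟙_ A)
  twist_tensor : ∀ X Y : A, twistIso.hom.app (X ⊗ Y) =
    (twistIso.hom.app X ⊗ₘ twistIso.hom.app Y) ≫ (β_ X Y).hom ≫ (β_ Y X).hom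

/-- The component `θ_X : X ⟶ X` of the balancing. -/
def twist {A : Type u} [Category.{v} A] [MonoidalCategory A] [BraidedCategory A] [Balancing A]
    (X : A) : X ⟶ X :=
  (Balancing.twistIso (A := A)).hom.app X

section Center

variable (A : Type u) [Category.{v} A] [MonoidalCategory A] [BraidedCategory A]

/-- The objects of the Müger center: those which trivially double braid with every object. -/
def muegerCenter : ObjectProperty A :=
  fun X ↦ ∀ Y : A, (β_ X Y).hom ≫ (β_ Y X).hom = 𝟙 (X ⊗ Y)

/-- The objects of the balanced Müger center: transparent objects with trivial balancing. -/
def balancedMuegerCenter [Balancing A] : ObjectProperty A :=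
  fun X ↦ muegerCenter A X ∧ twist X = 𝟙 X

lemma muegerCenter_unit : muegerCenter A (𝟙_ A) := by
  intro Y
  simp

lemma muegerCenter_tensor {X Y : A} (hX : muegerCenter A X) (hY : muegerCenter A Y) :
    muegerCenter A (X ⊗ Y) := by
  intro Z
  have h1 := hX Z
  have h2 := hY Z
  rw [BraidedCategory.braiding_tensor_left_hom, BraidedCategory.braiding_tensor_right_hom]
  simp only [Category.assoc, Iso.hom_inv_id_assoc]
  rw [← comp_whiskerRight_assoc, h1]
  simp only [id_whiskerRight, Category.id_comp, Iso.inv_hom_id_assoc]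
  rw [← MonoidalCategory.whiskerLeft_comp_assoc, h2]
  simp

/-- The balanced Müger center is a monoidal (full) subcategory. -/
instance [Balancing A] : (balancedMuegerCenter A).IsMonoidal where
  prop_unit := ⟨muegerCenter_unit A, Balancing.twist_unit⟩
  prop_tensor X Y hX hY := by
    refine ⟨muegerCenter_tensor A hX.1 hY.1, ?_⟩
    have h := Balancing.twist_tensor X Y
    change twist (X ⊗ Y) = (twist X ⊗ₘ twist Y) ≫ _ at h
    rw [h, hX.2, hY.2, hX.1 Y]
    simp

end Center

section Picard

variable (M : Type u) [Category.{v} M] [MonoidalCategory M]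

/-- The objects which are invertible with respect to the monoidal product. -/
def invertibleObject : ObjectProperty M :=
  fun X ↦ ∃ Y : M, Nonempty (X ⊗ Y ≅ 𝟙_ M) ∧ Nonempty (Y ⊗ X ≅ 𝟙_ M)

/-- The Picard groupoid: invertible objects and isomorphisms between them. -/
abbrev PicardGroupoid : Type u := Core (invertibleObject M).FullSubcategory

/-- The monoidal unit as object of the Picard groupoid. -/
def PicardGroupoid.unit : PicardGroupoid M :=
  ⟨⟨𝟙_ M, 𝟙_ M, ⟨λ_ (𝟙_ M)⟩, ⟨λ_ (𝟙_ M)⟩⟩⟩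

end Picard

/-- `PIC(Z₂^bal(A))`: the Picard groupoid of the balanced Müger center, seen as a 2-groupoid whose
only 2-morphisms are identities. -/
abbrev PIC (A : Type u) [Category.{v} A] [MonoidalCategory A] [BraidedCategory A]
    [Balancing A] : Type u :=
  LocallyDiscrete (PicardGroupoid (balancedMuegerCenter A).FullSubcategory)

section Structures

variable (k : Type w) [Field k] (A : Type u) [Category.{v} A] [Abelian A] [Linear k A]
  [MonoidalCategory A] [BraidedCategory A] [Balancing A]

/-! ## Automorphisms of the balanced braided category -/

/-- Balanced braided autoequivalences of `A`: linear braided monoidal autoequivalences which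
preserve the balancing (as equivalences, they are automatically left exact). -/
structure BalAut where
  F : A ⥤ A
  [braided : F.Braided]
  [additive : F.Additive]
  [linear : F.Linear k]
  [isEquivalence : F.IsEquivalence]
  map_twist : ∀ X : A, F.map (twist X) = twist (F.obj X)

attribute [instance] BalAut.braided BalAut.additive BalAut.linear BalAut.isEquivalence

variable {k A}

namespace BalAut

/-- Monoidal natural isomorphisms. -/
@[ext]
structure Hom (F G : BalAut k A) where
  iso : F.F ≅ G.F
  [isMonoidal : NatTrans.IsMonoidal iso.hom]

attribute [instance] Hom.isMonoidal

instance category : Category (BalAut k A) where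
  Hom F G := Hom F G
  id F := Hom.mk (Iso.refl F.F) (isMonoidal := NatTrans.IsMonoidal.id)
  comp a b := Hom.mk (Hom.iso a ≪≫ Hom.iso b) (isMonoidal := NatTrans.IsMonoidal.comp _ _)

variable (k A) in
/-- The identity functor. -/
def refl : BalAut k A where
  F := 𝟭 A
  map_twist _ := rfl

/-- Composition of autoequivalences: first `F`, then `G`. -/
def trans (F G : BalAut k A) : BalAut k A where
  F := F.F ⋙ G.F
  map_twist X := by simp [F.map_twist, G.map_twist]

/-- The component of a 2-morphism at an object. -/
def app {F G : BalAut k A} (a : F ⟶ G) (X : A) : F.F.obj X ⟶ G.F.obj X :=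
  (Hom.iso a).hom.app X

lemma hom_ext {F G : BalAut k A} {a b : F ⟶ G} (h : ∀ X, app a X = app b X) : a = b :=
  Hom.ext (Iso.ext (NatTrans.ext (funext h)))

@[simp] lemma id_app (F : BalAut k A) (X : A) : app (𝟙 F) X = 𝟙 (F.F.obj X) := rfl

@[simp] lemma comp_app {F G H : BalAut k A} (a : F ⟶ G) (b : G ⟶ H) (X : A) :
    app (a ≫ b) X = app a X ≫ app b X := rfl

lemma app_naturality {F G : BalAut k A} (a : F ⟶ G) {X Y : A} (f : X ⟶ Y) :
    F.F.map f ≫ app a Y = app a X ≫ G.F.map f :=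
  (Hom.iso a).hom.naturality f

/-- A monoidal natural isomorphism as an isomorphism of balanced braided autoequivalences. -/
def isoMk {F G : BalAut k A} (e : F.F ≅ G.F) (h : NatTrans.IsMonoidal e.hom) : F ≅ G where
  hom := Hom.mk e
  inv := Hom.mk e.symm (isMonoidal := inferInstanceAs (NatTrans.IsMonoidal e.inv))
  hom_inv_id := Hom.ext e.self_symm_id
  inv_hom_id := Hom.ext e.symm_self_id

/-- Left whiskering of monoidal natural isomorphisms. -/
def whiskerLeft (F : BalAut k A) {G H : BalAut k A} (a : G ⟶ H) : F.trans G ⟶ F.trans H :=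
  Hom.mk (Functor.isoWhiskerLeft F.F (Hom.iso a))
    (isMonoidal := inferInstanceAs
      (NatTrans.IsMonoidal (Functor.whiskerLeft F.F (Hom.iso a).hom)))

/-- Right whiskering of monoidal natural isomorphisms. -/
def whiskerRight {F G : BalAut k A} (a : F ⟶ G) (H : BalAut k A) : F.trans H ⟶ G.trans H :=
  Hom.mk (Functor.isoWhiskerRight (Hom.iso a) H.F)
    (isMonoidal := inferInstanceAs
      (NatTrans.IsMonoidal (Functor.whiskerRight (Hom.iso a).hom H.F)))

/-- Composition of autoequivalences is associative. -/
def associator (F G H : BalAut k A) : (F.trans G).trans H ≅ F.trans (G.trans H) :=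
  isoMk (F := (F.trans G).trans H) (G := F.trans (G.trans H)) (Functor.associator F.F G.F H.F)
    (inferInstanceAs (NatTrans.IsMonoidal (Functor.associator F.F G.F H.F).hom))

/-- Left unitality. -/
def leftUnitor (F : BalAut k A) : (refl k A).trans F ≅ F :=
  isoMk (F := (refl k A).trans F) F.F.leftUnitor
    (inferInstanceAs (NatTrans.IsMonoidal F.F.leftUnitor.hom))

/-- Right unitality. -/
def rightUnitor (F : BalAut k A) : F.trans (refl k A) ≅ F :=
  isoMk (F := F.trans (refl k A)) F.F.rightUnitor
    (inferInstanceAs (NatTrans.IsMonoidal F.F.rightUnitor.hom))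

@[simp] lemma whiskerLeft_app (F : BalAut k A) {G H : BalAut k A} (a : G ⟶ H) (X : A) :
    app (whiskerLeft F a) X = app a (F.F.obj X) := rfl

@[simp] lemma whiskerRight_app {F G : BalAut k A} (a : F ⟶ G) (H : BalAut k A) (X : A) :
    app (whiskerRight a H) X = H.F.map (app a X) := rfl

@[simp] lemma associator_hom_app (F G H : BalAut k A) (X : A) :
    app (associator F G H).hom X = 𝟙 (H.F.obj (G.F.obj (F.F.obj X))) := rfl

@[simp] lemma associator_inv_app (F G H : BalAut k A) (X : A) :
    app (associator F G H).inv X = 𝟙 (H.F.obj (G.F.obj (F.F.obj X))) := rfl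

@[simp] lemma leftUnitor_hom_app (F : BalAut k A) (X : A) :
    app (leftUnitor F).hom X = 𝟙 (F.F.obj X) := rfl

@[simp] lemma leftUnitor_inv_app (F : BalAut k A) (X : A) :
    app (leftUnitor F).inv X = 𝟙 (F.F.obj X) := rfl

@[simp] lemma rightUnitor_hom_app (F : BalAut k A) (X : A) :
    app (rightUnitor F).hom X = 𝟙 (F.F.obj X) := rfl

@[simp] lemma rightUnitor_inv_app (F : BalAut k A) (X : A) :
    app (rightUnitor F).inv X = 𝟙 (F.F.obj X) := rfl

end BalAut

lemma eq_id_comp_comp_id {V : Type u} [Category.{v} V] {X Y : V} (f : X ⟶ Y) :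
    f = 𝟙 X ≫ f ≫ 𝟙 Y := by
  simp

/-- The type of objects of `B AUT_{fE₂}(A)`: it has one element. -/
inductive BAUT (k : Type w) (A : Type u) : Type
  | star

section

open BalAut

/-- The one-object 2-groupoid `B AUT_{fE₂}(A)`: its 1-morphisms are the balanced braided
autoequivalences of `A`, its 2-morphisms the monoidal natural isomorphisms. -/
instance BAUT.bicategory : Bicategory (BAUT k A) where
  Hom _ _ := BalAut k A
  id _ := BalAut.refl k A
  comp F G := BalAut.trans F G
  homCategory _ _ := BalAut.category
  whiskerLeft F _ _ a := BalAut.whiskerLeft F a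
  whiskerRight a H := BalAut.whiskerRight a H
  associator F G H := BalAut.associator F G H
  leftUnitor F := BalAut.leftUnitor F
  rightUnitor F := BalAut.rightUnitor F
  whiskerLeft_id _ _ := rfl
  whiskerLeft_comp _ _ _ _ _ _ := rfl
  id_whiskerLeft a := hom_ext fun X ↦ eq_id_comp_comp_id (app a X)
  comp_whiskerLeft F G _ _ a := hom_ext fun X ↦ eq_id_comp_comp_id (app a (G.F.obj (F.F.obj X)))
  id_whiskerRight F G := hom_ext fun X ↦ G.F.map_id (F.F.obj X)
  comp_whiskerRight a b G := hom_ext fun X ↦ G.F.map_comp (app a X) (app b X)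
  whiskerRight_id a := hom_ext fun X ↦ eq_id_comp_comp_id (app a X)
  whiskerRight_comp a G H := hom_ext fun X ↦ eq_id_comp_comp_id (H.F.map (G.F.map (app a X)))
  whisker_assoc F _ _ a H := hom_ext fun X ↦ eq_id_comp_comp_id (H.F.map (app a (F.F.obj X)))
  whisker_exchange {_ _ _ _ _ _ _} a b := hom_ext fun X ↦ (app_naturality b (app a X)).symm
  pentagon F G H I := hom_ext fun X ↦ by
    change I.F.map (𝟙 (H.F.obj (G.F.obj (F.F.obj X)))) ≫ 𝟙 _ ≫ 𝟙 _ = 𝟙 _ ≫ 𝟙 _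
    rw [CategoryTheory.Functor.map_id]
    exact Category.id_comp _
  triangle F G := hom_ext fun X ↦ by
    change 𝟙 _ ≫ 𝟙 _ = G.F.map (𝟙 (F.F.obj X))
    rw [CategoryTheory.Functor.map_id]
    exact Category.id_comp _

end

/-! ## Ribbon Grothendieck-Verdier structures -/

variable (k A) in
/-- A ribbon Grothendieck-Verdier structure on the balanced braided category `A`: a dualizing
object `K`, the duality functor `D` with the isomorphisms `A(DX, Y) ≅ A(K, X ⊗ Y)` natural in `X`
and `Y`, such that `D : A ⟶ Aᵒᵖ` is an equivalence and `θ_{DX} = D θ_X`. -/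
structure RibbonGV where
  K : A
  D : A ⥤ Aᵒᵖ
  [isEquivalence : D.IsEquivalence]
  rep : ∀ X Y : A, ((D.obj X).unop ⟶ Y) ≃ₗ[k] (K ⟶ X ⊗ Y)
  rep_natural_left : ∀ {X X' : A} (f : X ⟶ X') (Y : A) (h : (D.obj X).unop ⟶ Y),
    rep X' Y ((D.map f).unop ≫ h) = rep X Y h ≫ f ▷ Y
  rep_natural_right : ∀ (X : A) {Y Y' : A} (g : Y ⟶ Y') (h : (D.obj X).unop ⟶ Y),
    rep X Y' (h ≫ g) = rep X Y h ≫ X ◁ g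
  ribbon : ∀ X : A, twist (D.obj X).unop = (D.map (twist X)).unop

attribute [instance] RibbonGV.isEquivalence

namespace RibbonGV

/-- The pairing `κ(X, Y) = A(DX, Y)`. -/
abbrev Pairing (S : RibbonGV k A) (X Y : A) : Type v := (S.D.obj X).unop ⟶ Y

/-- Functoriality of the pairing. -/
def pairingMap (S : RibbonGV k A) {X X' Y Y' : A} (f : X ⟶ X') (g : Y ⟶ Y')
    (h : S.Pairing X Y) : S.Pairing X' Y' :=
  (S.D.map f).unop ≫ h ≫ g

/-- The isomorphism `γ : κ(I, X ⊗ Y) ≅ κ(X, Y)`, the composite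
`A(DI, X ⊗ Y) ≅ A(K, I ⊗ (X ⊗ Y)) ≅ A(K, X ⊗ Y) ≅ A(DX, Y)`. -/
def gamma (S : RibbonGV k A) (X Y : A) : S.Pairing (𝟙_ A) (X ⊗ Y) ≃ₗ[k] S.Pairing X Y :=
  S.rep (𝟙_ A) (X ⊗ Y) ≪≫ₗ
    Linear.homCongr k (Iso.refl S.K) (MonoidalCategory.leftUnitor (X ⊗ Y)) ≪≫ₗ (S.rep X Y).symm

/-- Cyclic balanced braided equivalences between two ribbon Grothendieck-Verdier structures on `A`:
balanced braided autoequivalences `F` with an isomorphism `t : κ_S(X, Y) ≅ κ_T(F X, F Y)` of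
pairings, natural in `X` and `Y`, and compatible with the isomorphisms `γ` of `S` and `T`. -/
structure CyclicEquiv (S T : RibbonGV k A) where
  bal : BalAut k A
  t : ∀ X Y : A, S.Pairing X Y ≃ₗ[k] T.Pairing (bal.F.obj X) (bal.F.obj Y)
  t_natural : ∀ {X X' Y Y' : A} (f : X ⟶ X') (g : Y ⟶ Y') (h : S.Pairing X Y),
    t X' Y' (S.pairingMap f g h) = T.pairingMap (bal.F.map f) (bal.F.map g) (t X Y h)
  t_gamma : ∀ (X Y : A) (h : S.Pairing (𝟙_ A) (X ⊗ Y)),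
    t X Y (S.gamma X Y h) = T.gamma (bal.F.obj X) (bal.F.obj Y)
      (T.pairingMap (Functor.OplaxMonoidal.η bal.F) (Functor.OplaxMonoidal.δ bal.F X Y)
        (t (𝟙_ A) (X ⊗ Y) h))

namespace CyclicEquiv

variable {S T U V : RibbonGV k A}

/-- Cyclic isomorphisms: monoidal natural isomorphisms compatible with the isomorphisms of
pairings. -/
@[ext]
structure Hom (f g : CyclicEquiv S T) where
  iso : f.bal ⟶ g.bal
  w : ∀ (X Y : A) (h : S.Pairing X Y),
    T.pairingMap (BalAut.app iso X) (BalAut.app iso Y) (f.t X Y h) = g.t X Y h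

end CyclicEquiv

lemma pairingMap_id (S : RibbonGV k A) {X Y : A} (h : S.Pairing X Y) :
    S.pairingMap (𝟙 X) (𝟙 Y) h = h := by
  simp [pairingMap]

lemma pairingMap_comp (S : RibbonGV k A) {X X' X'' Y Y' Y'' : A} (f : X ⟶ X') (f' : X' ⟶ X'')
    (g : Y ⟶ Y') (g' : Y' ⟶ Y'') (h : S.Pairing X Y) :
    S.pairingMap (f ≫ f') (g ≫ g') h = S.pairingMap f' g' (S.pairingMap f g h) := by
  simp [pairingMap]

namespace CyclicEquiv

variable {S T U V : RibbonGV k A}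

/-- The identity cyclic equivalence. -/
def refl (S : RibbonGV k A) : CyclicEquiv S S where
  bal := BalAut.refl k A
  t X Y := LinearEquiv.refl k (S.Pairing X Y)
  t_natural _ _ _ := rfl
  t_gamma X Y h := congrArg (S.gamma X Y) (S.pairingMap_id h).symm

/-- Composition of cyclic equivalences. -/
def trans (f : CyclicEquiv S T) (g : CyclicEquiv T U) : CyclicEquiv S U where
  bal := f.bal.trans g.bal
  t X Y := f.t X Y ≪≫ₗ g.t (f.bal.F.obj X) (f.bal.F.obj Y)
  t_natural a b h := by
    change g.t _ _ (f.t _ _ (S.pairingMap a b h)) = _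
    rw [f.t_natural, g.t_natural]
    rfl
  t_gamma X Y h := by
    change g.t _ _ (f.t _ _ (S.gamma X Y h)) = _
    rw [f.t_gamma, g.t_gamma, g.t_natural, ← pairingMap_comp]
    rfl

instance category : Category (CyclicEquiv S T) where
  Hom f g := Hom f g
  id f := Hom.mk (𝟙 f.bal) fun _ _ _ ↦ T.pairingMap_id _
  comp {f g h} a b := Hom.mk (Hom.iso a ≫ Hom.iso b) fun X Y x ↦ by
    rw [← Hom.w b, ← Hom.w a]
    exact T.pairingMap_comp _ _ _ _ _
  id_comp _ := Hom.ext (Category.id_comp _)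
  comp_id _ := Hom.ext (Category.comp_id _)
  assoc _ _ _ := Hom.ext (Category.assoc _ _ _)

/-- An isomorphism of the underlying balanced braided autoequivalences which is compatible with
the isomorphisms of pairings is a cyclic isomorphism. -/
def isoMk {f g : CyclicEquiv S T} (e : f.bal ≅ g.bal)
    (w : ∀ (X Y : A) (h : S.Pairing X Y),
      T.pairingMap (BalAut.app e.hom X) (BalAut.app e.hom Y) (f.t X Y h) = g.t X Y h) : f ≅ g where
  hom := Hom.mk e.hom w
  inv := Hom.mk e.inv fun X Y h ↦ by
    rw [← w, ← pairingMap_comp, ← BalAut.comp_app, ← BalAut.comp_app, e.hom_inv_id]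
    exact T.pairingMap_id _
  hom_inv_id := Hom.ext e.hom_inv_id
  inv_hom_id := Hom.ext e.inv_hom_id

end CyclicEquiv

open CyclicEquiv

/-- The 2-groupoid `RIBGV(A)`: its objects are the ribbon Grothendieck-Verdier structures on the
balanced braided category `A`, its 1-morphisms the cyclic balanced braided equivalences, and its
2-morphisms the cyclic isomorphisms. -/
instance bicategory : Bicategory (RibbonGV k A) where
  Hom S T := CyclicEquiv S T
  id S := CyclicEquiv.refl S
  comp f g := CyclicEquiv.trans f g
  homCategory _ _ := CyclicEquiv.category
  whiskerLeft f _ _ a := CyclicEquiv.Hom.mk (BalAut.whiskerLeft (bal f) (Hom.iso a))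
    fun _ _ _ ↦ Hom.w a _ _ _
  whiskerRight a h := CyclicEquiv.Hom.mk (BalAut.whiskerRight (Hom.iso a) (bal h))
    fun X Y x ↦ (h.t_natural _ _ _).symm.trans (congrArg (h.t _ _) (Hom.w a X Y x))
  associator f g h := isoMk (BalAut.associator (bal f) (bal g) (bal h))
    fun _ _ _ ↦ pairingMap_id _ _
  leftUnitor f := isoMk (BalAut.leftUnitor (bal f)) fun _ _ _ ↦ pairingMap_id _ _
  rightUnitor f := isoMk (BalAut.rightUnitor (bal f)) fun _ _ _ ↦ pairingMap_id _ _
  whiskerLeft_id f g := Hom.ext (Bicategory.whiskerLeft_id (B := BAUT k A) (a := .star) (b := .star) (c := .star) f.bal g.bal)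
  whiskerLeft_comp f _ _ _ a b := Hom.ext
    (Bicategory.whiskerLeft_comp (B := BAUT k A) (a := .star) (b := .star) (c := .star) f.bal a.iso b.iso)
  id_whiskerLeft a := Hom.ext (Bicategory.id_whiskerLeft (B := BAUT k A) (a := .star) (b := .star) a.iso)
  comp_whiskerLeft f g _ _ a := Hom.ext
    (Bicategory.comp_whiskerLeft (B := BAUT k A) (a := .star) (b := .star) (c := .star) (d := .star) f.bal g.bal a.iso)
  id_whiskerRight f g := Hom.ext
    (Bicategory.id_whiskerRight (B := BAUT k A) (a := .star) (b := .star) (c := .star) f.bal g.bal)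
  comp_whiskerRight a b g := Hom.ext
    (Bicategory.comp_whiskerRight (B := BAUT k A) (a := .star) (b := .star) (c := .star) a.iso b.iso g.bal)
  whiskerRight_id a := Hom.ext (Bicategory.whiskerRight_id (B := BAUT k A) (a := .star) (b := .star) a.iso)
  whiskerRight_comp a g h := Hom.ext
    (Bicategory.whiskerRight_comp (B := BAUT k A) (a := .star) (b := .star) (c := .star) (d := .star) a.iso g.bal h.bal)
  whisker_assoc f _ _ a h := Hom.ext
    (Bicategory.whisker_assoc (B := BAUT k A) (a := .star) (b := .star) (c := .star) (d := .star) f.bal a.iso h.bal)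
  whisker_exchange a b := Hom.ext
    (Bicategory.whisker_exchange (B := BAUT k A) (a := .star) (b := .star) (c := .star) a.iso b.iso)
  pentagon f g h i := Hom.ext
    (Bicategory.pentagon (B := BAUT k A) (a := .star) (b := .star) (c := .star) (d := .star) (e := .star) f.bal g.bal h.bal i.bal)
  triangle f g := Hom.ext (Bicategory.triangle (B := BAUT k A) (a := .star) (b := .star) (c := .star) f.bal g.bal)

variable (k A) in
/-- The forgetful map `q : RIBGV(A) ⟶ B AUT_{fE₂}(A)`. -/
def forget : RibbonGV k A ⥤ᵖ BAUT k A where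
  obj _ := BAUT.star
  map f := CyclicEquiv.bal f
  map₂ a := CyclicEquiv.Hom.iso a
  map₂_id _ := rfl
  map₂_comp _ _ := rfl
  mapId _ := Iso.refl _
  mapComp _ _ := Iso.refl _
  map₂_whisker_left f _ _ a := eq_id_comp_comp_id _
  map₂_whisker_right a h := eq_id_comp_comp_id _
  map₂_associator f g h := BalAut.hom_ext fun X ↦ by
    change 𝟙 _ = 𝟙 _ ≫ h.bal.F.map (𝟙 (g.bal.F.obj (f.bal.F.obj X))) ≫ 𝟙 _ ≫ 𝟙 _ ≫ 𝟙 _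
    rw [CategoryTheory.Functor.map_id]
    exact (Category.id_comp _).symm.trans (eq_id_comp_comp_id _ |>.trans (by simp))
  map₂_left_unitor f := BalAut.hom_ext fun X ↦ by
    change 𝟙 _ = 𝟙 _ ≫ f.bal.F.map (𝟙 X) ≫ 𝟙 _
    rw [CategoryTheory.Functor.map_id]
    exact eq_id_comp_comp_id _
  map₂_right_unitor f := BalAut.hom_ext fun X ↦ eq_id_comp_comp_id (𝟙 (f.bal.F.obj X))

end RibbonGV

end Structures

/-! By Yoneda, everything is expressed through dualizing objects. Since `κ(X, Y) ≅ A(K, X ⊗ Y)`,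
under which `γ` becomes a left unitor, an isomorphism of pairings over an autoequivalence `F` is the
same as an isomorphism `K' ≅ F K` (`ofIso`, `rep_t`), and a monoidal isomorphism is a 2-morphism of
`RIBGV` exactly if it intertwines these isomorphisms (`compatible_iff`). Inverses and lifts are then
found by solving one equation in `A`; lifting a 1-morphism `F` also needs the transported structure,
whose dualizing object is `F K`.

In the homotopy fiber, transport makes every path trivial. A 1-morphism from `S` to `T` with trivial
paths is, up to 2-isomorphism, a unique isomorphism `K_T ≅ K_S`, and parallel 2-morphisms are equal.
It remains to classify the dualizing objects. Any other one, `K'`, is `D M` for some `M`, and then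
`D' ≅ D(M ⊗ -)`. Hence `M ⊗ -` is an equivalence, so that `M` is invertible, and the ribbon
conditions for `D` and `D'` give `M ⊗ θ_X = θ_{M ⊗ X}`, which says that `M` lies in the balanced
Müger center. With `N` inverse to `M`, `K' ≅ N ⊗ K`; conversely, each such `N ⊗ K` is dualizing,
with duality `N ⊗ D(-)`. Finally, `A(I, Z) ≅ A(DZ, DI) ≅ A(K, Z ⊗ K)` shows that `- ⊗ K` is fully
faithful on invertible objects, so isomorphisms of dualizing objects are those of the Picard
groupoid. -/

/-! ## Bicategories in which all 1-morphisms have right inverses -/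

namespace TwoGpd

/-- If every 1-morphism of a bicategory has a right inverse up to isomorphism, then every
1-morphism is an equivalence. -/
lemma exists_equivalence_of_right_inverse {B : Type u₁} [Bicategory.{w₁, v₁} B]
    (H : ∀ ⦃a b : B⦄ (f : a ⟶ b), ∃ g : b ⟶ a, Nonempty (f ≫ g ≅ 𝟙 a)) {a b : B} (f : a ⟶ b) :
    ∃ e : Bicategory.Equivalence a b, e.hom = f := by
  obtain ⟨g, ⟨i⟩⟩ := H f
  obtain ⟨h, ⟨j⟩⟩ := H g
  -- As in a monoid: `h ≅ (f g) h ≅ f (g h) ≅ f`, so the right inverse `g` is two-sided.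
  have l : h ≅ f := (Bicategory.leftUnitor h).symm ≪≫ Bicategory.whiskerRightIso i.symm h ≪≫
    Bicategory.associator f g h ≪≫ Bicategory.whiskerLeftIso f j ≪≫ Bicategory.rightUnitor f
  exact ⟨Bicategory.Equivalence.mkOfAdjointifyCounit i.symm
    (Bicategory.whiskerLeftIso g l.symm ≪≫ j), rfl⟩

/-- In the homotopy fiber, right inverses can be lifted from the source. -/
lemma HoFiber.exists_right_inverse {B : Type u₁} [Bicategory.{w₁, v₁} B] {C : Type u₂}
    [Bicategory.{w₂, v₂} C] {F : B ⥤ᵖ C} {c : C}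
    (H : ∀ ⦃a b : B⦄ (f : a ⟶ b), ∃ g : b ⟶ a, Nonempty (f ≫ g ≅ 𝟙 a))
    ⦃x y : HoFiber F c⦄ (f : x ⟶ y) : ∃ g : y ⟶ x, Nonempty (f ≫ g ≅ 𝟙 x) := by
  obtain ⟨g, ⟨i⟩⟩ := H (Hom.map f)
  -- The filling is dictated by the requirement that `i` be a 2-morphism of the homotopy fiber.
  let fill : y.path ≫ F.map g ≅ x.path :=
    Bicategory.whiskerRightIso (Hom.fill f).symm (F.map g) ≪≫
      Bicategory.associator _ _ _ ≪≫
      Bicategory.whiskerLeftIso x.path ((F.mapComp _ _).symm ≪≫ F.map₂Iso i ≪≫ F.mapId _) ≪≫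
      Bicategory.rightUnitor _
  refine ⟨⟨g, fill⟩, ⟨isoMk i ?_⟩⟩
  rw [id_fill_hom, comp_fill_hom]
  simp [fill]

end TwoGpd

/-! ## Inverses of balanced braided autoequivalences -/

section

variable {C : Type u} [Category.{v} C] [MonoidalCategory C]

open Functor.LaxMonoidal Functor.OplaxMonoidal

/-- The monoidal structure of the inverse extends the lax structure which it carries as right
adjoint. -/
lemma CategoryTheory.Equivalence.inverseMonoidal_isMonoidal (e : C ≌ C) [e.functor.Monoidal] :
    letI := e.inverseMonoidal
    e.IsMonoidal :=
  letI := e.toAdjunction.rightAdjointLaxMonoidal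
  (inferInstance : e.toAdjunction.IsMonoidal)

/-- The inverse of a braided monoidal equivalence is braided monoidal. -/
@[reducible]
noncomputable def CategoryTheory.Equivalence.inverseBraided [BraidedCategory C] (e : C ≌ C) [e.functor.Braided] :
    e.inverse.Braided :=
  letI := e.inverseMonoidal
  haveI : e.IsMonoidal := e.inverseMonoidal_isMonoidal
  { braided := fun X Y ↦ e.functor.map_injective (by
      -- After applying the faithful functor `e.functor`, the structure map of the inverse is
      -- expressed by that of `e.functor` and the counit, both of which commute with the braiding.
      have h (X Y : C) : e.functor.map (μ e.inverse X Y) = δ e.functor _ _ ≫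
          (e.counitIso.hom.app X ⊗ₘ e.counitIso.hom.app Y) ≫ e.counitIso.inv.app (X ⊗ Y) := by
        rw [← e.functor_map_μ_inverse_comp_counitIso_hom_app_tensor_assoc]
        simp
      rw [Functor.map_comp, Functor.map_comp, h, h]
      simp [braiding_naturality_assoc]) }

lemma CategoryTheory.Equivalence.unitIso_isMonoidal (e : C ≌ C) [e.functor.Monoidal] :
    letI := e.inverseMonoidal
    NatTrans.IsMonoidal e.unitIso.hom := by
  let := e.inverseMonoidal
  have : e.IsMonoidal := e.inverseMonoidal_isMonoidal
  exact {
    unit := by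
      rw [Functor.LaxMonoidal.comp_ε, ← e.unitIso_hom_app_comp_inverse_map_η_functor, Category.assoc,
        ← Functor.map_comp]
      simp
    tensor := fun X Y ↦ by
      rw [Functor.LaxMonoidal.comp_μ]
      refine Eq.trans ?_ (e.unitIso_hom_app_tensor_comp_inverse_map_δ_functor_assoc X Y _)
      rw [← Functor.map_comp]
      simp }

end

section

variable {A : Type u} [Category.{v} A] [MonoidalCategory A] [BraidedCategory A] [Balancing A]

lemma twist_naturality {X Y : A} (f : X ⟶ Y) : f ≫ twist Y = twist X ≫ f :=
  (Balancing.twistIso (A := A)).hom.naturality f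

lemma twist_tensor (X Y : A) :
    twist (X ⊗ Y) = (twist X ⊗ₘ twist Y) ≫ (β_ X Y).hom ≫ (β_ Y X).hom :=
  Balancing.twist_tensor X Y

/-- The inverse of an equivalence which preserves the balancing preserves the balancing. -/
lemma inv_map_twist (F : A ⥤ A) [F.IsEquivalence] (hF : ∀ X, F.map (twist X) = twist (F.obj X))
    (X : A) : F.inv.map (twist X) = twist (F.inv.obj X) := by
  apply F.map_injective
  rw [hF]
  -- Followed by the counit, both sides agree by naturality of the counit and of the balancing.
  exact (cancel_mono (F.asEquivalence.counitIso.hom.app X)).1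
    ((F.asEquivalence.counitIso.hom.naturality (twist X)).trans (twist_naturality _))

end

section

variable {k : Type w} [Field k] {A : Type u} [Category.{v} A] [Abelian A] [Linear k A]
  [MonoidalCategory A] [BraidedCategory A] [Balancing A]

namespace BalAut

/-- The component of an isomorphism of balanced braided autoequivalences at an object. -/
def appIso {F G : BalAut k A} (a : F ≅ G) (X : A) : F.F.obj X ≅ G.F.obj X where
  hom := app a.hom X
  inv := app a.inv X
  hom_inv_id := by rw [← comp_app, a.hom_inv_id, id_app]
  inv_hom_id := by rw [← comp_app, a.inv_hom_id, id_app]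

/-- The inverse autoequivalence. -/
noncomputable def inverse (F : BalAut k A) : BalAut k A :=
  letI : F.F.asEquivalence.functor.Braided := F.braided
  letI : F.F.asEquivalence.functor.Additive := F.additive
  letI : F.F.asEquivalence.functor.Linear k := F.linear
  { F := F.F.asEquivalence.inverse
    braided := F.F.asEquivalence.inverseBraided
    map_twist := inv_map_twist F.F F.map_twist }

/-- An autoequivalence followed by its inverse is isomorphic to the identity. -/
noncomputable def unitIso (F : BalAut k A) : refl k A ≅ F.trans F.inverse :=
  letI : F.F.asEquivalence.functor.Braided := F.braided
  isoMk (F := refl k A) (G := F.trans F.inverse) F.F.asEquivalence.unitIso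
    F.F.asEquivalence.unitIso_isMonoidal

end BalAut

lemma BAUT.exists_right_inverse ⦃a b : BAUT k A⦄ (f : a ⟶ b) :
    ∃ g : b ⟶ a, Nonempty (f ≫ g ≅ 𝟙 a) :=
  ⟨BalAut.inverse f, ⟨(BalAut.unitIso f).symm⟩⟩

lemma BAUT.isIso ⦃a b : BAUT k A⦄ ⦃f g : a ⟶ b⦄ (η : f ⟶ g) : IsIso η :=
  (BalAut.isoMk (BalAut.Hom.iso η) (BalAut.Hom.isMonoidal η)).isIso_hom

lemma BAUT.isTwoGroupoid : TwoGpd.IsTwoGroupoid (BAUT k A) :=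
  ⟨BAUT.isIso, fun _ _ f ↦ TwoGpd.exists_equivalence_of_right_inverse BAUT.exists_right_inverse f⟩

end

/-! ## Ribbon Grothendieck-Verdier structures in terms of coevaluations -/

section

variable {k : Type w} [Field k] {A : Type u} [Category.{v} A] [Abelian A] [Linear k A]
  [MonoidalCategory A] [BraidedCategory A] [Balancing A]

namespace RibbonGV

/-- The coevaluation `K ⟶ X ⊗ DX`. -/
def coev (S : RibbonGV k A) (X : A) : S.K ⟶ X ⊗ (S.D.obj X).unop :=
  S.rep X _ (𝟙 _)

/-- Yoneda in the variable `Y`: the coevaluation is the universal element. -/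
lemma rep_eq (S : RibbonGV k A) {X Y : A} (h : (S.D.obj X).unop ⟶ Y) :
    S.rep X Y h = S.coev X ≫ X ◁ h := by
  rw [coev, ← rep_natural_right, Category.id_comp]

/-- Naturality of `rep` in `X` amounts to this dinaturality of the coevaluation. -/
lemma coev_whiskerRight (S : RibbonGV k A) {X X' : A} (f : X ⟶ X') :
    S.coev X ≫ f ▷ (S.D.obj X).unop = S.coev X' ≫ X' ◁ (S.D.map f).unop := by
  rw [← rep_eq, coev, ← rep_natural_left, Category.comp_id]

/-- The comparison `K ⟶ DI`. -/
def toDualUnit (S : RibbonGV k A) : S.K ⟶ (S.D.obj (𝟙_ A)).unop :=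
  S.coev (𝟙_ A) ≫ (MonoidalCategory.leftUnitor _).hom

lemma toDualUnit_comp (S : RibbonGV k A) {Y : A} (h : (S.D.obj (𝟙_ A)).unop ⟶ Y) :
    S.toDualUnit ≫ h = S.rep (𝟙_ A) Y h ≫ (MonoidalCategory.leftUnitor _).hom := by
  simp [toDualUnit, rep_eq]

/-- Precomposition with `toDualUnit` is the bijection `rep` at the unit followed by the left unitor.
-/
instance (S : RibbonGV k A) : IsIso S.toDualUnit := by
  rw [isIso_iff_coyoneda_map_bijective]
  intro Y
  have : (fun h : (S.D.obj (𝟙_ A)).unop ⟶ Y ↦ S.toDualUnit ≫ h) =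
      (S.rep (𝟙_ A) Y).toEquiv.trans ((MonoidalCategory.leftUnitor Y).homToEquiv) := by
    ext h
    exact S.toDualUnit_comp h
  rw [this]
  exact Equiv.bijective _

section

variable [MonoidalPreadditive A] [MonoidalLinear k A]

/-- A ribbon Grothendieck-Verdier structure from coevaluation maps. -/
noncomputable def ofCoev (K : A) (D : A ⥤ Aᵒᵖ) [D.IsEquivalence]
    (coev : ∀ X, K ⟶ X ⊗ (D.obj X).unop)
    (coev_whiskerRight : ∀ {X X' : A} (f : X ⟶ X'),
      coev X ≫ f ▷ (D.obj X).unop = coev X' ≫ X' ◁ (D.map f).unop)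
    (bijective : ∀ X Y, Function.Bijective fun h : (D.obj X).unop ⟶ Y ↦ coev X ≫ X ◁ h)
    (ribbon : ∀ X, twist (D.obj X).unop = (D.map (twist X)).unop) : RibbonGV k A where
  K := K
  D := D
  rep X Y := LinearEquiv.ofBijective
    { toFun := fun h : (D.obj X).unop ⟶ Y ↦ coev X ≫ X ◁ h
      map_add' := fun a b ↦ by simp
      map_smul' := fun a b ↦ by simp } (bijective X Y)
  rep_natural_left {X X'} f Y h := by
    change coev X' ≫ X' ◁ (_ ≫ h) = (coev X ≫ X ◁ h) ≫ f ▷ Y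
    rw [MonoidalCategory.whiskerLeft_comp, ← reassoc_of% (coev_whiskerRight f), Category.assoc,
      MonoidalCategory.whisker_exchange]
  rep_natural_right X Y Y' g h := by
    change coev X ≫ X ◁ (_ ≫ g) = (coev X ≫ X ◁ h) ≫ X ◁ g
    simp
  ribbon := ribbon

/-- Transport of a ribbon Grothendieck-Verdier structure along autoequivalences `G` and `E` which
preserve the balancing, such that `E` is linear over the inverse of `G` with respect to the left
action of `A` on itself. -/
noncomputable def transport (S : RibbonGV k A) (G E : A ⥤ A) [G.IsEquivalence] [E.IsEquivalence]
    (m : ∀ X Y, E.obj (G.obj X ⊗ Y) ≅ X ⊗ E.obj Y)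
    (m_whiskerRight : ∀ {X X' : A} (f : X ⟶ X') (Y : A),
      E.map (G.map f ▷ Y) ≫ (m X' Y).hom = (m X Y).hom ≫ f ▷ E.obj Y)
    (m_whiskerLeft : ∀ (X : A) {Y Y' : A} (g : Y ⟶ Y'),
      E.map (G.obj X ◁ g) ≫ (m X Y').hom = (m X Y).hom ≫ X ◁ E.map g)
    (hG : ∀ X, G.map (twist X) = twist (G.obj X))
    (hE : ∀ X, E.map (twist X) = twist (E.obj X)) : RibbonGV k A :=
  -- The new dual of `X` is `E D G X`, with coevaluation `E K ⟶ E (G X ⊗ D G X) ≅ X ⊗ E D G X`.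
  ofCoev (E.obj S.K) (G ⋙ S.D ⋙ E.op) (fun X ↦ E.map (S.coev (G.obj X)) ≫ (m _ _).hom)
    (fun {X X'} f ↦ by
      change (E.map (S.coev (G.obj X)) ≫ (m _ _).hom) ≫ f ▷ E.obj _ =
        (E.map (S.coev (G.obj X')) ≫ (m _ _).hom) ≫ X' ◁ E.map (S.D.map (G.map f)).unop
      rw [Category.assoc, ← m_whiskerRight, ← Functor.map_comp_assoc, S.coev_whiskerRight,
        Category.assoc, ← m_whiskerLeft, Functor.map_comp_assoc])
    (fun X Y ↦ by
      change Function.Bijective fun h : E.obj (S.D.obj (G.obj X)).unop ⟶ Y ↦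
        (E.map (S.coev (G.obj X)) ≫ (m _ _).hom) ≫ X ◁ h
      -- As `E` is full and essentially surjective, every morphism out of the new dual is `E h`
      -- followed by a fixed isomorphism; on these, the new map is `E` applied to the old bijection,
      -- up to isomorphism.
      have key (h : (S.D.obj (G.obj X)).unop ⟶ E.objPreimage Y) :
          (E.map (S.coev (G.obj X)) ≫ (m _ _).hom) ≫ X ◁ (E.map h ≫ (E.objObjPreimageIso Y).hom) =
            E.map (S.rep _ _ h) ≫ (m _ _ ≪≫ whiskerLeftIso X (E.objObjPreimageIso Y)).hom := by
        rw [rep_eq, Functor.map_comp, Category.assoc, Category.assoc, Iso.trans_hom,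
          reassoc_of% m_whiskerLeft, MonoidalCategory.whiskerLeft_comp, whiskerLeftIso_hom]
      constructor
      · intro a b hab
        obtain ⟨a, rfl⟩ : ∃ h, a = E.map h ≫ (E.objObjPreimageIso Y).hom :=
          ⟨E.preimage (a ≫ (E.objObjPreimageIso Y).inv), by simp⟩
        obtain ⟨b, rfl⟩ : ∃ h, b = E.map h ≫ (E.objObjPreimageIso Y).hom :=
          ⟨E.preimage (b ≫ (E.objObjPreimageIso Y).inv), by simp⟩
        dsimp only at hab
        rw [key, key, cancel_mono] at hab
        rw [(S.rep _ _).injective (E.map_injective hab)]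
      · intro g
        refine ⟨E.map ((S.rep _ _).symm (E.preimage (g ≫
          (m _ _ ≪≫ whiskerLeftIso X (E.objObjPreimageIso Y)).inv))) ≫
          (E.objObjPreimageIso Y).hom, ?_⟩
        dsimp only
        rw [key, LinearEquiv.apply_symm_apply, Functor.map_preimage, Category.assoc,
          Iso.inv_hom_id, Category.comp_id])
    (fun X ↦ by
      change twist (E.obj _) = E.map ((S.D.map (G.map (twist X))).unop)
      rw [hG, ← ribbon, hE])

end

end RibbonGV

end

/-! ## Cyclic equivalences in terms of dualizing objects -/

/-- A morphism `u : X ⟶ F Y` with `F` an equivalence is an isomorphism if composition with `u`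
induces bijections `Hom(Y, Z) ≅ Hom(X, F Z)`. -/
lemma CategoryTheory.Functor.isIso_of_bijective_comp_map {C : Type u} [Category.{v} C] (F : C ⥤ C)
    [F.IsEquivalence] {X Y : C} (u : X ⟶ F.obj Y)
    (h : ∀ Z, Function.Bijective fun g : Y ⟶ Z ↦ u ≫ F.map g) : IsIso u := by
  rw [isIso_iff_coyoneda_map_bijective]
  intro Z
  constructor
  · intro a b hab
    obtain ⟨a, rfl⟩ : ∃ g, a = F.map g ≫ (F.objObjPreimageIso Z).hom :=
      ⟨F.preimage (a ≫ (F.objObjPreimageIso Z).inv), by simp⟩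
    obtain ⟨b, rfl⟩ : ∃ g, b = F.map g ≫ (F.objObjPreimageIso Z).hom :=
      ⟨F.preimage (b ≫ (F.objObjPreimageIso Z).inv), by simp⟩
    dsimp only at hab
    rw [← Category.assoc, ← Category.assoc, cancel_mono] at hab
    rw [(h _).1 hab]
  · intro g
    obtain ⟨g', hg'⟩ := (h _).2 (g ≫ (F.objObjPreimageIso Z).inv)
    exact ⟨F.map g' ≫ (F.objObjPreimageIso Z).hom, by
      simpa using hg' =≫ (F.objObjPreimageIso Z).hom⟩

section

variable {k : Type w} [Field k] {A : Type u} [Category.{v} A] [Abelian A] [Linear k A]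
  [MonoidalCategory A] [BraidedCategory A] [Balancing A]

/-- The action of a balanced braided autoequivalence on morphisms, as a linear equivalence. -/
noncomputable def BalAut.homLinearEquiv (F : BalAut k A) (X Y : A) :
    (X ⟶ Y) ≃ₗ[k] (F.F.obj X ⟶ F.F.obj Y) :=
  LinearEquiv.ofBijective (F.F.mapLinearMap k) ⟨F.F.map_injective, F.F.map_surjective⟩

@[simp] lemma BalAut.homLinearEquiv_apply (F : BalAut k A) {X Y : A} (f : X ⟶ Y) :
    F.homLinearEquiv X Y f = F.F.map f := rfl

namespace RibbonGV

open Functor.LaxMonoidal Functor.OplaxMonoidal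

lemma rep_pairingMap (S : RibbonGV k A) {X X' Y Y' : A} (f : X ⟶ X') (g : Y ⟶ Y')
    (h : S.Pairing X Y) :
    S.rep X' Y' (S.pairingMap f g h) = S.rep X Y h ≫ f ▷ Y ≫ X' ◁ g := by
  rw [pairingMap, ← Category.assoc, rep_natural_right, rep_natural_left, Category.assoc]

/-- Seen in `A(K, X ⊗ Y)`, `γ` only removes a unit; conditions on pairings are therefore checked
after applying `rep`. -/
lemma rep_gamma (S : RibbonGV k A) (X Y : A) (h : S.Pairing (𝟙_ A) (X ⊗ Y)) :
    S.rep X Y (S.gamma X Y h) = S.rep (𝟙_ A) (X ⊗ Y) h ≫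
      (MonoidalCategory.leftUnitor (X ⊗ Y)).hom := by
  simp [gamma, Linear.homCongr_apply]

namespace CyclicEquiv

variable {S T : RibbonGV k A}

/-- A cyclic equivalence from an isomorphism of dualizing objects. -/
noncomputable def ofIso (F : BalAut k A) (e : T.K ≅ F.F.obj S.K) : CyclicEquiv S T where
  bal := F
  -- `A(K, X ⊗ Y) ≅ A(F K, F (X ⊗ Y)) ≅ A(K', F X ⊗ F Y)`, by applying `F` and composing with `e`
  -- and `δ`.
  t X Y := (S.rep X Y ≪≫ₗ F.homLinearEquiv _ _ ≪≫ₗ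
    Linear.homCongr k e.symm (Functor.Monoidal.μIso F.F X Y).symm) ≪≫ₗ (T.rep _ _).symm
  t_natural {X X' Y Y'} f g h := by
    apply (T.rep _ _).injective
    rw [rep_pairingMap]
    simp [Linear.homCongr_apply, rep_pairingMap]
  t_gamma X Y h := by
    apply (T.rep _ _).injective
    rw [rep_gamma, rep_pairingMap]
    simp [Linear.homCongr_apply, rep_gamma]

lemma rep_ofIso_t (F : BalAut k A) (e : T.K ≅ F.F.obj S.K) (X Y : A) (h : S.Pairing X Y) :
    T.rep _ _ ((ofIso F e).t X Y h) = e.hom ≫ F.F.map (S.rep X Y h) ≫ δ F.F X Y := by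
  dsimp only [ofIso]
  erw [LinearEquiv.trans_apply, LinearEquiv.apply_symm_apply]
  simp [Linear.homCongr_apply]

/-- The morphism of dualizing objects underlying a cyclic equivalence. -/
noncomputable def dualizing (f : CyclicEquiv S T) : T.K ⟶ f.bal.F.obj S.K :=
  -- The element `inv S.toDualUnit` of `κ(I, K)` corresponds to the identity of `K`, hence is
  -- universal.
  T.rep _ _ (f.t (𝟙_ A) S.K (inv S.toDualUnit)) ≫ μ f.bal.F (𝟙_ A) S.K ≫
    f.bal.F.map (MonoidalCategory.leftUnitor S.K).hom

/-- Every element of `κ(I, Y)` is the image of the universal one under a morphism `K ⟶ Y`, so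
naturality of `t` reduces to that element. -/
lemma dualizing_comp (f : CyclicEquiv S T) {Y : A} (h : S.Pairing (𝟙_ A) Y) :
    f.dualizing ≫ f.bal.F.map (S.toDualUnit ≫ h) = T.rep _ _ (f.t (𝟙_ A) Y h) ≫
      μ f.bal.F (𝟙_ A) Y ≫ f.bal.F.map (MonoidalCategory.leftUnitor Y).hom := by
  have hh : h = S.pairingMap (𝟙 (𝟙_ A)) (S.toDualUnit ≫ h) (inv S.toDualUnit) := by
    simp [pairingMap]
  conv_rhs => rw [hh, f.t_natural, rep_pairingMap]
  simp only [dualizing, CategoryTheory.Functor.map_id, id_whiskerRight, Category.id_comp, Category.assoc,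
    μ_natural_right_assoc, ← Functor.map_comp, leftUnitor_naturality]

/-- Compatibility with `γ` reduces `κ(X, Y)` to `κ(I, X ⊗ Y)`, where `dualizing_comp` applies. Thus
`t` is determined by one morphism of dualizing objects. -/
lemma rep_t (f : CyclicEquiv S T) (X Y : A) (h : S.Pairing X Y) :
    T.rep _ _ (f.t X Y h) = f.dualizing ≫ f.bal.F.map (S.rep X Y h) ≫ δ f.bal.F X Y := by
  obtain ⟨h, rfl⟩ := (S.gamma X Y).surjective h
  rw [f.t_gamma, rep_gamma, rep_pairingMap, rep_gamma, ← toDualUnit_comp,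
    reassoc_of% (f.dualizing_comp h)]
  simp

/-- Up to isomorphisms, `g ↦ f.dualizing ≫ F g` is the bijection `t` on `κ(I, Z)`. -/
instance (f : CyclicEquiv S T) : IsIso f.dualizing := by
  apply f.bal.F.isIso_of_bijective_comp_map
  intro Z
  have key (g : S.K ⟶ Z) : f.dualizing ≫ f.bal.F.map g =
      T.rep _ _ (f.t (𝟙_ A) Z (inv S.toDualUnit ≫ g)) ≫ (Functor.Monoidal.μIso f.bal.F _ _ ≪≫
        f.bal.F.mapIso (MonoidalCategory.leftUnitor Z)).hom := by
    simpa using f.dualizing_comp (inv S.toDualUnit ≫ g)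
  constructor
  · intro a b hab
    dsimp only at hab
    rw [key, key, cancel_mono] at hab
    exact (cancel_epi (inv S.toDualUnit)).1 ((f.t _ _).injective ((T.rep _ _).injective hab))
  · intro g
    refine ⟨S.toDualUnit ≫ (f.t _ _).symm ((T.rep _ _).symm (g ≫
      (Functor.Monoidal.μIso f.bal.F (𝟙_ A) Z ≪≫
        f.bal.F.mapIso (MonoidalCategory.leftUnitor Z)).inv)), ?_⟩
    dsimp only
    rw [key, IsIso.inv_hom_id_assoc, LinearEquiv.apply_symm_apply, LinearEquiv.apply_symm_apply,
      Category.assoc, Iso.inv_hom_id, Category.comp_id]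

/-- The formula of `rep_t` characterizes the morphism of dualizing objects: evaluate it at the
universal element of `κ(I, K)`. -/
lemma dualizing_eq (f : CyclicEquiv S T) (u : T.K ⟶ f.bal.F.obj S.K)
    (hu : ∀ (X Y : A) (h : S.Pairing X Y),
      T.rep _ _ (f.t X Y h) = u ≫ f.bal.F.map (S.rep X Y h) ≫ δ f.bal.F X Y) :
    f.dualizing = u := by
  have h := hu (𝟙_ A) S.K (inv S.toDualUnit)
  have h' := S.toDualUnit_comp (inv S.toDualUnit)
  rw [IsIso.hom_inv_id] at h'
  rw [dualizing, h, Category.assoc, Category.assoc, Functor.Monoidal.δ_μ_assoc,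
    ← Functor.map_comp, ← h', CategoryTheory.Functor.map_id, Category.comp_id]

@[simp]
lemma dualizing_ofIso (F : BalAut k A) (e : T.K ≅ F.F.obj S.K) :
    (ofIso F e).dualizing = e.hom :=
  dualizing_eq _ _ fun _ _ _ ↦ rep_ofIso_t F e _ _ _

lemma dualizing_refl (S : RibbonGV k A) : (refl S).dualizing = 𝟙 S.K := by
  refine dualizing_eq _ _ fun X Y h ↦ ?_
  change S.rep X Y h = 𝟙 _ ≫ S.rep X Y h ≫ 𝟙 _
  simp

lemma dualizing_trans {U : RibbonGV k A} (f : CyclicEquiv S T) (g : CyclicEquiv T U) :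
    (trans f g).dualizing = g.dualizing ≫ g.bal.F.map f.dualizing := by
  refine dualizing_eq _ _ fun X Y h ↦ ?_
  change U.rep _ _ (g.t _ _ (f.t X Y h)) = (g.dualizing ≫ g.bal.F.map f.dualizing) ≫
    g.bal.F.map (f.bal.F.map (S.rep X Y h)) ≫ δ (f.bal.F ⋙ g.bal.F) X Y
  rw [rep_t, rep_t]
  simp

/-- A monoidal natural isomorphism is compatible with the isomorphisms of pairings if and only if
it is compatible with the morphisms of dualizing objects. -/
lemma compatible_iff {f g : CyclicEquiv S T} (a : f.bal ⟶ g.bal) :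
    (∀ (X Y : A) (h : S.Pairing X Y),
      T.pairingMap (BalAut.app a X) (BalAut.app a Y) (f.t X Y h) = g.t X Y h) ↔
    f.dualizing ≫ BalAut.app a S.K = g.dualizing := by
  have key (X Y : A) (h : S.Pairing X Y) :
      T.rep _ _ (T.pairingMap (BalAut.app a X) (BalAut.app a Y) (f.t X Y h)) =
        (f.dualizing ≫ BalAut.app a S.K) ≫ g.bal.F.map (S.rep X Y h) ≫ δ g.bal.F X Y := by
    -- Monoidality of `a`, restated for the inverse structure maps `δ`.
    have h1 : δ f.bal.F X Y ≫ (BalAut.app a X ⊗ₘ BalAut.app a Y) =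
        BalAut.app a (X ⊗ Y) ≫ δ g.bal.F X Y := by
      have := NatTrans.IsMonoidal.tensor (τ := (BalAut.Hom.iso a).hom) X Y
      rw [← cancel_epi (μ f.bal.F X Y), Functor.Monoidal.μ_δ_assoc]
      exact ((Category.assoc _ _ _).symm.trans (this =≫ δ g.bal.F X Y) |>.trans (by
        rw [Category.assoc, Functor.Monoidal.μ_δ, Category.comp_id]; rfl)).symm
    rw [rep_pairingMap, rep_t, Category.assoc, Category.assoc, Category.assoc,
      ← reassoc_of% (BalAut.app_naturality a (S.rep X Y h)), ← h1,
      MonoidalCategory.tensorHom_def]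
  constructor
  · intro h
    exact (dualizing_eq g _ fun X Y x ↦ by rw [← h, key]).symm
  · intro h X Y x
    exact (T.rep _ _).injective (by rw [key, h, rep_t])

end CyclicEquiv

lemma unit_comp_map_inv {C : Type u} [Category.{v} C] {F G : C ⥤ C} (η : 𝟭 C ≅ F ⋙ G) {X Y : C}
    (d : Y ⟶ F.obj X) [IsIso d] :
    ((η.hom.app X ≫ G.map (inv d)) ≫ G.map d) ≫ η.inv.app X = 𝟙 X := by
  have h : G.map (inv d) ≫ G.map d = 𝟙 _ := by
    rw [← Functor.map_comp, IsIso.inv_hom_id, CategoryTheory.Functor.map_id]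
  rw [Category.assoc, Category.assoc, reassoc_of% h]
  exact η.hom_inv_id_app X

lemma exists_right_inverse ⦃S T : RibbonGV k A⦄ (f : S ⟶ T) :
    ∃ g : T ⟶ S, Nonempty (f ≫ g ≅ 𝟙 S) := by
  revert f
  intro (f : CyclicEquiv S T)
  let F : BalAut k A := f.bal
  -- The only choice for which the unit isomorphism of `F` satisfies the criterion `compatible_iff`.
  let e : S.K ≅ F.inverse.F.obj T.K :=
    F.F.asEquivalence.unitIso.app S.K ≪≫
      (F.inverse.F.mapIso (asIso f.dualizing)).symm
  let g : CyclicEquiv T S := CyclicEquiv.ofIso F.inverse e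
  refine ⟨g, ⟨CyclicEquiv.isoMk (f := CyclicEquiv.trans f g) (g := CyclicEquiv.refl S)
    F.unitIso.symm ?_⟩⟩
  rw [CyclicEquiv.compatible_iff, CyclicEquiv.dualizing_refl, CyclicEquiv.dualizing_trans,
    CyclicEquiv.dualizing_ofIso]
  exact unit_comp_map_inv (F := F.F) F.F.asEquivalence.unitIso f.dualizing

lemma isTwoGroupoid : TwoGpd.IsTwoGroupoid (RibbonGV k A) :=
  ⟨fun _ _ _ _ η ↦ (CyclicEquiv.isoMk (BalAut.isoMk (BalAut.Hom.iso (CyclicEquiv.Hom.iso η))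
      (BalAut.Hom.isMonoidal _)) (CyclicEquiv.Hom.w η)).isIso_hom,
    fun _ _ f ↦ TwoGpd.exists_equivalence_of_right_inverse exists_right_inverse f⟩

end RibbonGV

end

/-! ## The forgetful map is a fibration -/

section

variable {k : Type w} [Field k] {A : Type u} [Category.{v} A] [Abelian A] [Linear k A]
  [MonoidalCategory A] [BraidedCategory A] [Balancing A]

/-- The counit isomorphism `F (F⁻¹ X) ≅ X`. -/
noncomputable def BalAut.counitApp (F : BalAut k A) (X : A) : F.F.obj (F.F.inv.obj X) ≅ X :=
  F.F.asEquivalence.counitIso.app X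

lemma BalAut.counitApp_naturality (F : BalAut k A) {X Y : A} (f : X ⟶ Y) :
    F.F.map (F.F.inv.map f) ≫ (F.counitApp Y).hom = (F.counitApp X).hom ≫ f :=
  F.F.asEquivalence.counitIso.hom.naturality f

namespace RibbonGV

open Functor.LaxMonoidal Functor.OplaxMonoidal

/-- Transport of a ribbon Grothendieck-Verdier structure along a balanced braided
autoequivalence. -/
noncomputable def transportAlong [MonoidalPreadditive A] [MonoidalLinear k A]
    (S : RibbonGV k A) (F : BalAut k A) : RibbonGV k A :=
  S.transport F.F.inv F.F
    -- `F (F⁻¹ X ⊗ Y) ≅ F F⁻¹ X ⊗ F Y ≅ X ⊗ F Y`.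
    (fun X Y ↦ (Functor.Monoidal.μIso F.F (F.F.inv.obj X) Y).symm ≪≫
      whiskerRightIso (F.counitApp X) (F.F.obj Y))
    (fun {X X'} f Y ↦ by
      simp only [Iso.trans_hom, Iso.symm_hom, Functor.Monoidal.μIso_inv, whiskerRightIso_hom,
        ← δ_natural_left_assoc, Category.assoc, ← comp_whiskerRight, F.counitApp_naturality])
    (fun X {Y Y'} g ↦ by
      simp only [Iso.trans_hom, Iso.symm_hom, Functor.Monoidal.μIso_inv, whiskerRightIso_hom,
        ← δ_natural_right_assoc, Category.assoc, MonoidalCategory.whisker_exchange])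
    (inv_map_twist F.F F.map_twist) F.map_twist

/-- The cyclic equivalence from a ribbon Grothendieck-Verdier structure to its transport. -/
noncomputable def toTransportAlong [MonoidalPreadditive A] [MonoidalLinear k A]
    (S : RibbonGV k A) (F : BalAut k A) : CyclicEquiv S (S.transportAlong F) :=
  -- The transported dualizing object is `F K` by definition.
  CyclicEquiv.ofIso F (Iso.refl _)

/-- A 2-isomorphism in `RIBGV(A)` with prescribed image and prescribed source. -/
lemma exists_hom_of_iso {S T : RibbonGV k A} (f : CyclicEquiv S T) {G : BalAut k A}
    (a : f.bal ≅ G) : ∃ (g : CyclicEquiv S T) (b : f ≅ g),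
      (⟨g.bal, b.hom.iso⟩ : Σ H : BalAut k A, f.bal ⟶ H) = ⟨G, a.hom⟩ := by
  -- By `compatible_iff`, the isomorphism of dualizing objects over `G` is forced.
  refine ⟨CyclicEquiv.ofIso G (asIso f.dualizing ≪≫ BalAut.appIso a S.K),
    CyclicEquiv.isoMk (g := CyclicEquiv.ofIso G _) a ?_, rfl⟩
  rw [CyclicEquiv.compatible_iff, CyclicEquiv.dualizing_ofIso]
  rfl

lemma forget_isFibration [MonoidalPreadditive A] [MonoidalLinear k A] :
    TwoGpd.IsFibration (RibbonGV.forget k A) where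
  lift_one S c F := by
    cases c
    exact ⟨S.transportAlong F, S.toTransportAlong F, rfl⟩
  lift_two S T U f g χ σ := by
    obtain ⟨h, τ, e⟩ := exists_hom_of_iso (f := CyclicEquiv.trans f g) (G := χ) σ
    refine ⟨h, τ, ?_⟩
    refine Eq.trans ?_ e
    -- The forgetful map preserves composition strictly, so its compositor is an identity.
    exact congrArg (Sigma.mk _) (Category.id_comp _)

end RibbonGV

end

/-! ## Dualizing objects and the balanced Müger center -/

section

variable {C : Type u} [Category.{v} C] [MonoidalCategory C]

/-- The isomorphism `M ⊗ (N ⊗ X) ≅ X` induced by `M ⊗ N ≅ I`. -/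
def tensorCancelIso {M N : C} (e : M ⊗ N ≅ 𝟙_ C) (X : C) : M ⊗ (N ⊗ X) ≅ X :=
  (MonoidalCategory.associator M N X).symm ≪≫ whiskerRightIso e X ≪≫
    MonoidalCategory.leftUnitor X

lemma tensorCancelIso_naturality {M N : C} (e : M ⊗ N ≅ 𝟙_ C) {X Y : C} (f : X ⟶ Y) :
    M ◁ N ◁ f ≫ (tensorCancelIso e Y).hom = (tensorCancelIso e X).hom ≫ f := by
  simp only [tensorCancelIso, Iso.trans_hom, Iso.symm_hom, whiskerRightIso_hom, Category.assoc]
  rw [MonoidalCategory.associator_inv_naturality_right_assoc,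
    MonoidalCategory.whisker_exchange_assoc, MonoidalCategory.leftUnitor_naturality]

lemma tensorLeft_isEquivalence {M N : C} (e : M ⊗ N ≅ 𝟙_ C) (e' : N ⊗ M ≅ 𝟙_ C) :
    (tensorLeft M).IsEquivalence :=
  (CategoryTheory.Equivalence.mk (tensorLeft M) (tensorLeft N)
    (NatIso.ofComponents (tensorCancelIso e') (tensorCancelIso_naturality e')).symm
    (NatIso.ofComponents (tensorCancelIso e)
      (tensorCancelIso_naturality e))).isEquivalence_functor

end

section

variable {A : Type u} [Category.{v} A] [MonoidalCategory A] [BraidedCategory A] [Balancing A]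

lemma isIso_twist (X : A) : IsIso (twist X) :=
  inferInstanceAs (IsIso ((Balancing.twistIso (A := A)).hom.app X))

/-- The case `X = I` forces `θ_N` to be trivial; the balancing formula then leaves the double
braiding, since `N ◁ θ_X` is invertible. This is the form in which the ribbon condition detects the
balanced Müger center. -/
lemma balancedMuegerCenter_iff (N : A) :
    balancedMuegerCenter A N ↔ ∀ X, N ◁ twist X = twist (N ⊗ X) := by
  constructor
  · rintro ⟨h, h'⟩ X
    rw [twist_tensor, h', h X, Category.comp_id, id_tensorHom]
  · intro h
    have h1 : twist N = 𝟙 N := by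
      have := twist_naturality (MonoidalCategory.rightUnitor N).hom
      rw [← h, show twist (𝟙_ A) = 𝟙 _ from Balancing.twist_unit] at this
      rw [← cancel_epi (MonoidalCategory.rightUnitor N).hom]
      simpa using this
    refine ⟨fun X ↦ ?_, h1⟩
    have hX := h X
    rw [twist_tensor, h1, id_tensorHom] at hX
    have := isIso_twist X
    rw [← cancel_epi (N ◁ twist X)]
    exact hX.symm.trans (Category.comp_id _).symm

end

section

variable {k : Type w} [Field k] {A : Type u} [Category.{v} A] [Abelian A] [Linear k A]
  [MonoidalCategory A] [BraidedCategory A] [Balancing A]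

namespace RibbonGV

/-- The ribbon Grothendieck-Verdier structure with dualizing object `N ⊗ K`, for an invertible
object `N` of the balanced Müger center. -/
noncomputable def tensor [MonoidalPreadditive A] [MonoidalLinear k A]
    (S : RibbonGV k A) (N : A) [(tensorLeft N).IsEquivalence]
    (hN : balancedMuegerCenter A N) : RibbonGV k A :=
  S.transport (𝟭 A) (tensorLeft N)
    -- `N ⊗ (X ⊗ Y) ≅ X ⊗ (N ⊗ Y)` by the braiding; only its naturality in `X` and `Y` is needed.
    (fun X Y ↦ (MonoidalCategory.associator N X Y).symm ≪≫ whiskerRightIso (β_ N X) Y ≪≫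
      MonoidalCategory.associator X N Y)
    (fun {X X'} f Y ↦ by
      change N ◁ f ▷ Y ≫ _ = _ ≫ f ▷ (N ⊗ Y)
      simp only [Iso.trans_hom, Iso.symm_hom, whiskerRightIso_hom, Category.assoc]
      rw [MonoidalCategory.associator_inv_naturality_middle_assoc, ← comp_whiskerRight_assoc,
        braiding_naturality_right]
      simp)
    (fun X {Y Y'} g ↦ by
      change N ◁ X ◁ g ≫ _ = _ ≫ X ◁ N ◁ g
      simp only [Iso.trans_hom, Iso.symm_hom, whiskerRightIso_hom, Category.assoc]
      rw [MonoidalCategory.associator_inv_naturality_right_assoc,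
        MonoidalCategory.whisker_exchange_assoc, MonoidalCategory.associator_naturality_right])
    -- Membership in the balanced Müger center enters only here, for the ribbon condition.
    (fun _ ↦ rfl) ((balancedMuegerCenter_iff N).1 hN)

/-! ### Full faithfulness of `- ⊗ K` on invertible objects. -/

lemma coev_unit (S : RibbonGV k A) :
    S.coev (𝟙_ A) = S.toDualUnit ≫ (MonoidalCategory.leftUnitor _).inv := by
  simp [toDualUnit]

/-- `A(I, Z) ≅ A(DZ, DI) ≅ A(K, Z ⊗ DI) ≅ A(K, Z ⊗ K)`, since `D` is fully faithful; `key`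
identifies the composite. -/
lemma bijective_whiskerRight_unit (S : RibbonGV k A) (Z : A) : Function.Bijective
    fun g : 𝟙_ A ⟶ Z ↦ (MonoidalCategory.leftUnitor S.K).inv ≫ g ▷ S.K := by
  have key (g : 𝟙_ A ⟶ Z) : ((MonoidalCategory.leftUnitor S.K).inv ≫ g ▷ S.K) ≫
      (whiskerLeftIso Z (asIso S.toDualUnit)).hom = S.rep Z _ (S.D.map g).unop := by
    rw [rep_eq, ← coev_whiskerRight, coev_unit]
    rw [Category.assoc, Category.assoc, whiskerLeftIso_hom, ← MonoidalCategory.whisker_exchange,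
      asIso_hom, MonoidalCategory.leftUnitor_inv_naturality_assoc]
  constructor
  · intro g g' h
    have := key g
    dsimp only at h
    rw [h, key] at this
    exact S.D.map_injective (Quiver.Hom.unop_inj ((S.rep _ _).injective this.symm))
  · intro h
    obtain ⟨a, ha⟩ := (S.rep _ _).surjective (h ≫ (whiskerLeftIso Z (asIso S.toDualUnit)).hom)
    obtain ⟨g, hg⟩ := S.D.map_surjective a.op
    refine ⟨g, ?_⟩
    dsimp only
    rw [← cancel_mono (whiskerLeftIso Z (asIso S.toDualUnit)).hom, key, hg, ← ha]
    rfl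

/-- The functor `- ⊗ K` is fully faithful on invertible objects. -/
lemma bijective_whiskerRight (S : RibbonGV k A) {M X : A} [(tensorLeft M).IsEquivalence]
    (e : M ⊗ X ≅ 𝟙_ A) (X' : A) :
    Function.Bijective fun g : X ⟶ X' ↦ g ▷ S.K := by
  constructor
  · intro g g' h
    dsimp only at h
    apply (tensorLeft M).map_injective
    rw [← cancel_epi e.inv]
    apply (S.bijective_whiskerRight_unit _).1
    simp [h]
  · intro f
    -- Tensoring with `M` replaces the source `X` by `M ⊗ X ≅ I`, which reduces the claim to the
    -- case of the unit.
    obtain ⟨g₀, hg₀⟩ := (S.bijective_whiskerRight_unit (M ⊗ X')).2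
      ((MonoidalCategory.leftUnitor S.K).inv ≫ e.inv ▷ S.K ≫
        (MonoidalCategory.associator _ _ _).hom ≫ M ◁ f ≫
        (MonoidalCategory.associator _ _ _).inv)
    obtain ⟨g, hg⟩ := (tensorLeft M).map_surjective (e.hom ≫ g₀)
    refine ⟨g, (tensorLeft M).map_injective ?_⟩
    change M ◁ g = _ at hg
    change M ◁ g ▷ S.K = M ◁ f
    dsimp only at hg₀
    rw [cancel_epi] at hg₀
    rw [← cancel_mono (MonoidalCategory.associator _ _ _).inv,
      MonoidalCategory.associator_inv_naturality_middle, hg, comp_whiskerRight, hg₀]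
    simp

lemma exists_iso_of_tensor_iso (S : RibbonGV k A) {M X M' X' : A}
    [(tensorLeft M).IsEquivalence] [(tensorLeft M').IsEquivalence] (e : M ⊗ X ≅ 𝟙_ A)
    (e' : M' ⊗ X' ≅ 𝟙_ A) (f : X ⊗ S.K ≅ X' ⊗ S.K) :
    ∃ g : X ≅ X', g.hom ▷ S.K = f.hom := by
  obtain ⟨g, hg⟩ := (S.bijective_whiskerRight e X').2 f.hom
  obtain ⟨g', hg'⟩ := (S.bijective_whiskerRight e' X).2 f.inv
  dsimp only at hg hg'
  refine ⟨⟨g, g', (S.bijective_whiskerRight e X).1 ?_, (S.bijective_whiskerRight e' X').1 ?_⟩, hg⟩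
  · simp [hg, hg']
  · simp [hg, hg']

/-! ### Comparison of two ribbon Grothendieck-Verdier structures. -/

section

variable {S T : RibbonGV k A} {M : A} (v : T.K ≅ (S.D.obj M).unop)

/-- If the dualizing object of `T` is `D M`, then `D_T X` and `D (M ⊗ X)` corepresent the same
functor. -/
def dualEquiv (X Y : A) : ((T.D.obj X).unop ⟶ Y) ≃ ((S.D.obj (M ⊗ X)).unop ⟶ Y) :=
  -- `A(D_T X, Y) ≅ A(K_T, X ⊗ Y) ≅ A(DM, X ⊗ Y) ≅ A(K, M ⊗ (X ⊗ Y)) ≅ A(D(M ⊗ X), Y)`.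
  (T.rep X Y).toEquiv.trans ((v.homCongr (Iso.refl _)).trans ((S.rep M (X ⊗ Y)).toEquiv.trans
    (((Iso.refl S.K).homCongr (MonoidalCategory.associator M X Y).symm).trans
      (S.rep (M ⊗ X) Y).toEquiv.symm)))

lemma rep_dualEquiv (X Y : A) (h : (T.D.obj X).unop ⟶ Y) :
    S.rep (M ⊗ X) Y (dualEquiv v X Y h) = S.rep M (X ⊗ Y) (v.inv ≫ T.rep X Y h) ≫
      (MonoidalCategory.associator M X Y).inv := by
  simp [dualEquiv, Iso.homCongr]

lemma dualEquiv_comp (X : A) {Y Y' : A} (h : (T.D.obj X).unop ⟶ Y) (g : Y ⟶ Y') :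
    dualEquiv v X Y' (h ≫ g) = dualEquiv v X Y h ≫ g := by
  apply (S.rep _ _).injective
  simp only [rep_dualEquiv, rep_natural_right, ← Category.assoc]
  simp

lemma dualEquiv_map {X X' : A} (f : X ⟶ X') (Y : A) (h : (T.D.obj X).unop ⟶ Y) :
    dualEquiv v X' Y ((T.D.map f).unop ≫ h) =
      (S.D.map (M ◁ f)).unop ≫ dualEquiv v X Y h := by
  apply (S.rep _ _).injective
  rw [rep_dualEquiv, rep_natural_left, rep_natural_left, rep_dualEquiv, ← Category.assoc,
    rep_natural_right, Category.assoc, Category.assoc,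
    MonoidalCategory.associator_inv_naturality_middle]

/-- If the dualizing object of `T` is `D M`, then the duality functor of `T` is `D (M ⊗ -)`. -/
def dualIso : T.D ≅ tensorLeft M ⋙ S.D :=
  NatIso.ofComponents (fun X ↦ Iso.op
    { hom := dualEquiv v X _ (𝟙 _)
      inv := (dualEquiv v X _).symm (𝟙 _)
      hom_inv_id := by
        rw [← dualEquiv_comp, Category.id_comp, Equiv.apply_symm_apply]
        rfl
      inv_hom_id := by
        apply (dualEquiv v X _).injective
        rw [dualEquiv_comp, Equiv.apply_symm_apply]
        exact Category.id_comp _ })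
    (fun {X X'} f ↦ Quiver.Hom.unop_inj (by
      change dualEquiv v X' _ (𝟙 _) ≫ (T.D.map f).unop =
        (S.D.map (M ◁ f)).unop ≫ dualEquiv v X _ (𝟙 _)
      rw [← dualEquiv_comp, ← dualEquiv_map, Category.comp_id, Category.id_comp]))

/-- A dualizing object `D M` of a ribbon Grothendieck-Verdier structure comes from an invertible
object `M` of the balanced Müger center. -/
lemma tensorLeft_isEquivalence_of_dual (v : T.K ≅ (S.D.obj M).unop) :
    (tensorLeft M).IsEquivalence :=
  -- `M ⊗ -` followed by the equivalence `D` is isomorphic to the equivalence `D_T`.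
  have := Functor.isEquivalence_of_iso (dualIso v)
  Functor.isEquivalence_of_comp_right (tensorLeft M) S.D

/-- Under `D_T ≅ D(M ⊗ -)`, `D(M ⊗ θ_X)` corresponds to `D_T θ_X = θ_{D_T X}`, hence by naturality
of `θ` equals `θ_{D(M ⊗ X)} = D θ_{M ⊗ X}`. As `D` is faithful, `M ⊗ θ_X = θ_{M ⊗ X}`. -/
lemma balancedMuegerCenter_of_dual (v : T.K ≅ (S.D.obj M).unop) : balancedMuegerCenter A M := by
  rw [balancedMuegerCenter_iff]
  intro X
  apply S.D.map_injective
  apply Quiver.Hom.unop_inj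
  have nat : ((dualIso v).hom.app X).unop ≫ (T.D.map (twist X)).unop =
      (S.D.map (M ◁ twist X)).unop ≫ ((dualIso v).hom.app X).unop :=
    congrArg Quiver.Hom.unop ((dualIso v).hom.naturality (twist X))
  rw [← cancel_mono ((dualIso v).hom.app X).unop, ← nat, ← S.ribbon, ← T.ribbon]
  exact twist_naturality _

/-- Yoneda: `A(DM, Y) ≅ A(K, M ⊗ Y) ≅ A(N ⊗ K, N ⊗ (M ⊗ Y)) ≅ A(N ⊗ K, Y)`. -/
lemma dual_tensor (S : RibbonGV k A) {M N : A} (e : M ⊗ N ≅ 𝟙_ A) (e' : N ⊗ M ≅ 𝟙_ A) :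
    Nonempty (N ⊗ S.K ≅ (S.D.obj M).unop) := by
  have := tensorLeft_isEquivalence e' e
  let f : N ⊗ S.K ⟶ (S.D.obj M).unop := N ◁ S.coev M ≫ (tensorCancelIso e' _).hom
  suffices IsIso f from ⟨asIso f⟩
  rw [isIso_iff_coyoneda_map_bijective]
  intro Y
  have : (fun h : (S.D.obj M).unop ⟶ Y ↦ f ≫ h) = (S.rep M Y).toEquiv.trans
      ((Functor.FullyFaithful.ofFullyFaithful (tensorLeft N)).homEquiv.trans
        (tensorCancelIso e' Y).homToEquiv) := by
    ext h
    change f ≫ h = N ◁ S.rep M Y h ≫ _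
    simp [f, rep_eq, tensorCancelIso_naturality]
  rw [this]
  exact Equiv.bijective _

/-- Any two ribbon Grothendieck-Verdier structures differ by an invertible object of the balanced
Müger center. -/
lemma exists_tensor_iso (S T : RibbonGV k A) : ∃ M N : A, balancedMuegerCenter A M ∧
    balancedMuegerCenter A N ∧ Nonempty (M ⊗ N ≅ 𝟙_ A) ∧ Nonempty (N ⊗ S.K ≅ T.K) := by
  let M := S.D.objPreimage (Opposite.op T.K)
  let v : T.K ≅ (S.D.obj M).unop := (S.D.objObjPreimageIso (Opposite.op T.K)).unop
  have := tensorLeft_isEquivalence_of_dual v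
  let N := (tensorLeft M).objPreimage (𝟙_ A)
  let e : M ⊗ N ≅ 𝟙_ A := (tensorLeft M).objObjPreimageIso (𝟙_ A)
  -- `K ≅ DI ≅ D(M ⊗ N) ≅ D_T N`, so the previous argument with `S` and `T` exchanged puts `N` in
  -- the balanced Müger center.
  let v' : S.K ≅ (T.D.obj N).unop :=
    asIso S.toDualUnit ≪≫ (S.D.mapIso e).unop ≪≫ ((dualIso v).app N).unop
  obtain ⟨i⟩ := S.dual_tensor e (β_ N M ≪≫ e)
  exact ⟨M, N, balancedMuegerCenter_of_dual v, balancedMuegerCenter_of_dual v', ⟨e⟩,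
    ⟨i ≪≫ v.symm⟩⟩

end

end RibbonGV

end

/-! ## The homotopy fiber of the forgetful map -/

section

variable {k : Type w} [Field k] {A : Type u} [Category.{v} A] [Abelian A] [Linear k A]
  [MonoidalCategory A] [BraidedCategory A] [Balancing A]

namespace RibbonGV

open TwoGpd

/-- The homotopy fiber of the forgetful map. -/
abbrev Fiber (k : Type w) [Field k] (A : Type u) [Category.{v} A] [Abelian A] [Linear k A]
    [MonoidalCategory A] [BraidedCategory A] [Balancing A] :=
  HoFiber (forget k A) BAUT.star

namespace Fiber

/-- A 1-morphism of the homotopy fiber seen as a cyclic equivalence. -/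
def cyc {x y : Fiber k A} (f : x ⟶ y) : CyclicEquiv x.obj y.obj := HoFiber.Hom.map f

/-- The path of an object of the homotopy fiber. -/
def bal (x : Fiber k A) : BalAut k A := x.path

/-- The filling of a 1-morphism of the homotopy fiber. -/
def fill {x y : Fiber k A} (f : x ⟶ y) : (bal x).trans (cyc f).bal ≅ bal y := HoFiber.Hom.fill f

/-- Reduces 2-isomorphisms of the homotopy fiber to equations between morphisms of `A`. -/
lemma nonempty_iso_iff {x y : Fiber k A} (f g : x ⟶ y) : Nonempty (f ≅ g) ↔
    ∃ a : (cyc f).bal ≅ (cyc g).bal,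
      (cyc f).dualizing ≫ BalAut.app a.hom x.obj.K = (cyc g).dualizing ∧
      ∀ X, BalAut.app a.hom ((bal x).F.obj X) ≫ BalAut.app (fill g).hom X =
        BalAut.app (fill f).hom X := by
  constructor
  · rintro ⟨i⟩
    let c : HoFiber.Hom.map f ≅ HoFiber.Hom.map g :=
      ⟨HoFiber.Hom₂.cell i.hom, HoFiber.Hom₂.cell i.inv,
        congrArg HoFiber.Hom₂.cell i.hom_inv_id, congrArg HoFiber.Hom₂.cell i.inv_hom_id⟩
    refine ⟨⟨CyclicEquiv.Hom.iso c.hom, CyclicEquiv.Hom.iso c.inv,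
      congrArg CyclicEquiv.Hom.iso c.hom_inv_id, congrArg CyclicEquiv.Hom.iso c.inv_hom_id⟩,
      ?_, fun X ↦ ?_⟩
    · exact (CyclicEquiv.compatible_iff _).1 (CyclicEquiv.Hom.w c.hom)
    · exact congrArg (fun b ↦ BalAut.app b X) (HoFiber.Hom₂.w i.hom)
  · rintro ⟨a, ha, hX⟩
    exact ⟨HoFiber.isoMk (CyclicEquiv.isoMk (f := cyc f) (g := cyc g) a
      ((CyclicEquiv.compatible_iff _).2 ha)) (BalAut.hom_ext hX)⟩

/-- All 2-morphisms of the homotopy fiber are invertible. -/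
noncomputable def isoOfHom {x y : Fiber k A} {f g : x ⟶ y} (a : f ⟶ g) : f ≅ g :=
  have := (isTwoGroupoid (k := k) (A := A)).1 (HoFiber.Hom₂.cell a)
  HoFiber.isoMk (asIso (HoFiber.Hom₂.cell a)) (HoFiber.Hom₂.w a)

/-- As the filling of `g` is invertible, the filling condition determines a 2-morphism on the image
of the path of `x`, which is essentially surjective. -/
instance {x y : Fiber k A} (f g : x ⟶ y) : Subsingleton (f ⟶ g) where
  allEq a b := HoFiber.hom₂_ext (CyclicEquiv.Hom.ext (BalAut.hom_ext fun X ↦ by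
    let α : (cyc f).bal ⟶ (cyc g).bal := CyclicEquiv.Hom.iso (HoFiber.Hom₂.cell a)
    let β : (cyc f).bal ⟶ (cyc g).bal := CyclicEquiv.Hom.iso (HoFiber.Hom₂.cell b)
    change BalAut.app α X = BalAut.app β X
    have h : BalAut.whiskerLeft (bal x) α ≫ (fill g).hom =
        BalAut.whiskerLeft (bal x) β ≫ (fill g).hom :=
      (HoFiber.Hom₂.w a).trans (HoFiber.Hom₂.w b).symm
    rw [cancel_mono] at h
    have h' := congrArg (fun c ↦ BalAut.app c ((bal x).F.objPreimage X)) h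
    dsimp only [BalAut.whiskerLeft_app] at h'
    have e := (bal x).F.objObjPreimageIso X
    rw [← cancel_epi ((cyc f).bal.F.map e.hom), BalAut.app_naturality, BalAut.app_naturality, h']))

/-- The object of the homotopy fiber with the identity path. -/
abbrev of (S : RibbonGV k A) : Fiber k A := ⟨S, 𝟙 BAUT.star⟩

/-- The 1-morphism of the homotopy fiber given by an isomorphism of dualizing objects. -/
noncomputable def homOfIso {S T : RibbonGV k A} (e : T.K ≅ S.K) : of S ⟶ of T :=
  HoFiber.Hom.mk (F := forget k A) (c := BAUT.star) (x := of S) (y := of T)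
    (CyclicEquiv.ofIso (BalAut.refl k A) e)
    (BalAut.leftUnitor (BalAut.refl k A))

lemma dualizing_homOfIso {S T : RibbonGV k A} (e : T.K ≅ S.K) :
    (cyc (homOfIso e)).dualizing = e.hom :=
  CyclicEquiv.dualizing_ofIso (BalAut.refl k A) e

lemma nonempty_homOfIso_refl (S : RibbonGV k A) :
    Nonempty (homOfIso (Iso.refl S.K) ≅ 𝟙 (of S)) := by
  rw [nonempty_iso_iff]
  refine ⟨Iso.refl (BalAut.refl k A), ?_, fun X ↦ ?_⟩
  · exact ((Category.comp_id _).trans (dualizing_homOfIso _)).trans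
      (CyclicEquiv.dualizing_refl S).symm
  · change 𝟙 X ≫ 𝟙 _ ≫ 𝟙 _ = 𝟙 X
    simp

lemma nonempty_homOfIso_comp {S T U : RibbonGV k A} (e : T.K ≅ S.K) (e' : U.K ≅ T.K) :
    Nonempty (homOfIso (e' ≪≫ e) ≅ homOfIso e ≫ homOfIso e') := by
  rw [nonempty_iso_iff]
  refine ⟨(BalAut.leftUnitor (BalAut.refl k A)).symm, ?_, fun X ↦ ?_⟩
  · refine ((Category.comp_id _).trans (dualizing_homOfIso _)).trans
      (Eq.trans ?_ (CyclicEquiv.dualizing_trans (cyc (homOfIso e)) (cyc (homOfIso e'))).symm)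
    exact (congrArg₂ (fun (x : U.K ⟶ T.K) (y : T.K ⟶ S.K) ↦ x ≫ y) (dualizing_homOfIso e')
      (dualizing_homOfIso e)).symm
  · change 𝟙 X ≫ 𝟙 X ≫ 𝟙 X ≫ 𝟙 X ≫ 𝟙 X = 𝟙 X
    simp

/-- Between trivial fillings, the filling condition forces the 2-isomorphism to be the identity. -/
lemma eq_of_nonempty_homOfIso {S T : RibbonGV k A} {e e' : T.K ≅ S.K}
    (h : Nonempty (homOfIso e ≅ homOfIso e')) : e = e' := by
  obtain ⟨a, h₁, h₂⟩ := (nonempty_iso_iff _ _).1 h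
  have h₃ : BalAut.app a.hom S.K = 𝟙 S.K := (Category.comp_id _).symm.trans (h₂ S.K)
  ext
  rw [← dualizing_homOfIso e, ← dualizing_homOfIso e']
  exact ((Category.comp_id _).symm.trans (congrArg (_ ≫ ·) h₃.symm)).trans h₁

/-- The filling of `f` identifies its autoequivalence with the identity; carrying `K_T ≅ F K_S`
along it gives `e`. -/
lemma exists_homOfIso {S T : RibbonGV k A} (f : of S ⟶ of T) :
    ∃ e : T.K ≅ S.K, Nonempty (homOfIso e ≅ f) := by
  let a : (cyc f).bal ≅ BalAut.refl k A := (BalAut.leftUnitor _).symm ≪≫ fill f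
  let c : (cyc f).bal.F.obj S.K ≅ S.K := BalAut.appIso a S.K
  refine ⟨asIso (cyc f).dualizing ≪≫ c, (nonempty_iso_iff _ _).2 ⟨a.symm, ?_, fun X ↦ ?_⟩⟩
  · refine (congrArg (fun x : T.K ⟶ S.K ↦ x ≫ c.inv) (dualizing_homOfIso _)).trans ?_
    simp
  · refine Eq.trans ?_ (congrArg (fun b ↦ BalAut.app b X) (fill f).inv_hom_id)
    exact congrArg (· ≫ BalAut.app (fill f).hom X) (Category.comp_id (BalAut.app (fill f).inv X))

lemma exists_equivalence {x y : Fiber k A} (f : x ⟶ y) :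
    Nonempty (Bicategory.Equivalence x y) :=
  ⟨(exists_equivalence_of_right_inverse
    (HoFiber.exists_right_inverse exists_right_inverse) f).choose⟩

/-- Every object of the homotopy fiber has a 1-morphism to an object with identity path. -/
lemma exists_hom_of [MonoidalPreadditive A] [MonoidalLinear k A] (x : Fiber k A) :
    ∃ S : RibbonGV k A, Nonempty (x ⟶ of S) :=
  -- Transport along the inverse of the path makes the new path trivial up to the unit isomorphism.
  ⟨x.obj.transportAlong (bal x).inverse,
    ⟨HoFiber.Hom.mk (F := forget k A) (c := BAUT.star) (x := x)
      (x.obj.toTransportAlong (bal x).inverse) (bal x).unitIso.symm⟩⟩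

end Fiber

/-! ## The Picard groupoid of the balanced Müger center -/

section Pic

variable (A) in
/-- The object of `A` underlying an object of `PIC(Z₂^bal(A))`. -/
def picObj (N : PIC A) : A := N.as.of.obj.obj

omit [Abelian A] in
lemma picObj_property (N : PIC A) : balancedMuegerCenter A (picObj A N) := N.as.of.obj.property

/-- The isomorphism in `A` underlying a 1-morphism of `PIC(Z₂^bal(A))`. -/
def picIso {N N' : PIC A} (f : N ⟶ N') : picObj A N ≅ picObj A N' :=
  ((invertibleObject _).ι ⋙ (balancedMuegerCenter A).ι).mapIso f.as.iso

omit [Abelian A] in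
lemma picIso_id (N : PIC A) : picIso (𝟙 N) = Iso.refl _ := rfl

omit [Abelian A] in
lemma picIso_comp {N N' N'' : PIC A} (f : N ⟶ N') (g : N' ⟶ N'') :
    picIso (f ≫ g) = picIso f ≪≫ picIso g := rfl

omit [Abelian A] in
lemma picIso_bijective (N N' : PIC A) :
    Function.Bijective (picIso : (N ⟶ N') → (picObj A N ≅ picObj A N')) := by
  constructor
  · rintro ⟨f⟩ ⟨g⟩ h
    exact congrArg Discrete.mk (CoreHom.ext (Functor.mapIso_injective
      ((invertibleObject _).ι ⋙ (balancedMuegerCenter A).ι) h))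
  · intro e
    exact ⟨⟨⟨(invertibleObject _).isoMk ((balancedMuegerCenter A).isoMk e)⟩⟩, rfl⟩

omit [Abelian A] in
lemma exists_inverse (N : PIC A) : ∃ M : A, Nonempty (M ⊗ picObj A N ≅ 𝟙_ A) ∧
    Nonempty (picObj A N ⊗ M ≅ 𝟙_ A) := by
  obtain ⟨M, ⟨e⟩, ⟨e'⟩⟩ := N.as.of.property
  exact ⟨M.obj, ⟨(balancedMuegerCenter A).ι.mapIso e'⟩, ⟨(balancedMuegerCenter A).ι.mapIso e⟩⟩

omit [Abelian A] in
lemma exists_picObj_eq {M N : A} (hM : balancedMuegerCenter A M) (hN : balancedMuegerCenter A N)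
    (e : M ⊗ N ≅ 𝟙_ A) : ∃ N' : PIC A, picObj A N' = N :=
  ⟨⟨⟨⟨⟨N, hN⟩, ⟨M, hM⟩, ⟨(balancedMuegerCenter A).isoMk (β_ N M ≪≫ e)⟩,
    ⟨(balancedMuegerCenter A).isoMk e⟩⟩⟩⟩, rfl⟩

end Pic

/-- A choice of ribbon Grothendieck-Verdier structures `T N` with dualizing object `N ⊗ K`. -/
lemma exists_family [MonoidalPreadditive A] [MonoidalLinear k A] (S : RibbonGV k A) :
    ∃ T : PIC A → RibbonGV k A, T ⟨PicardGroupoid.unit _⟩ = S ∧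
      ∀ N, Nonempty ((T N).K ≅ picObj A N ⊗ S.K) := by
  have (N : PIC A) : ∃ T : RibbonGV k A, (N = ⟨PicardGroupoid.unit _⟩ → T = S) ∧
      Nonempty (T.K ≅ picObj A N ⊗ S.K) := by
    -- The unit is treated apart so that its value is `S` itself, whereas `S.tensor` would have
    -- dualizing object `I ⊗ K`.
    by_cases hN : N = ⟨PicardGroupoid.unit _⟩
    · subst hN
      exact ⟨S, fun _ ↦ rfl, ⟨(MonoidalCategory.leftUnitor S.K).symm⟩⟩
    · obtain ⟨M, ⟨e⟩, ⟨e'⟩⟩ := exists_inverse N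
      have := tensorLeft_isEquivalence e' e
      exact ⟨S.tensor (picObj A N) (picObj_property N), fun h ↦ (hN h).elim, ⟨Iso.refl _⟩⟩
  choose T hT hK using this
  exact ⟨T, hT _ rfl, hK⟩

/-! ### The comparison from the Picard groupoid to the homotopy fiber. -/

section

variable {S : RibbonGV k A} {T : PIC A → RibbonGV k A} (j : ∀ N, (T N).K ≅ picObj A N ⊗ S.K)

/-- The isomorphism of dualizing objects induced by a 1-morphism of `PIC(Z₂^bal(A))`. -/
def dualizingIso {N N' : PIC A} (f : N ⟶ N') : (T N').K ≅ (T N).K :=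
  -- The inverse of `picIso f` appears because 1-morphisms of the fiber are contravariant in
  -- dualizing objects.
  j N' ≪≫ whiskerRightIso (picIso f).symm S.K ≪≫ (j N).symm

lemma dualizingIso_id (N : PIC A) : dualizingIso j (𝟙 N) = Iso.refl _ := by
  ext
  simp [dualizingIso, picIso_id]

lemma dualizingIso_comp {N N' N'' : PIC A} (f : N ⟶ N') (g : N' ⟶ N'') :
    dualizingIso j (f ≫ g) = dualizingIso j g ≪≫ dualizingIso j f := by
  ext
  simp [dualizingIso, picIso_comp]

/-- This is full faithfulness of `- ⊗ K` on invertible objects, conjugated by the isomorphisms `j`.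
-/
lemma dualizingIso_bijective (N N' : PIC A) :
    Function.Bijective (dualizingIso j : (N ⟶ N') → ((T N').K ≅ (T N).K)) := by
  obtain ⟨M, ⟨e⟩, ⟨e'⟩⟩ := exists_inverse N
  obtain ⟨M', ⟨d⟩, ⟨d'⟩⟩ := exists_inverse N'
  have := tensorLeft_isEquivalence e e'
  have := tensorLeft_isEquivalence d d'
  constructor
  · intro f g h
    have h := congrArg Iso.hom h
    simp only [dualizingIso, Iso.trans_hom, cancel_epi, cancel_mono, whiskerRightIso_hom] at h
    have := (S.bijective_whiskerRight d _).1 h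
    exact (picIso_bijective N N').1 (Iso.symm_bijective.1 (Iso.ext this))
  · intro f
    obtain ⟨g, hg⟩ := S.exists_iso_of_tensor_iso d e ((j N').symm ≪≫ f ≪≫ j N)
    obtain ⟨g', hg'⟩ := (picIso_bijective N N').2 g.symm
    refine ⟨g', ?_⟩
    ext
    simp [dualizingIso, hg', hg]

/-- The comparison from `PIC(Z₂^bal(A))` to the homotopy fiber. -/
noncomputable def picToFiber : PIC A ⥤ᵖ Fiber k A :=
  pseudofunctorOfIsLocallyDiscrete (fun N ↦ Fiber.of (T N))
    (fun f ↦ Fiber.homOfIso (dualizingIso j f))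
    (fun N ↦ eqToIso (by rw [dualizingIso_id]) ≪≫ (Fiber.nonempty_homOfIso_refl (T N)).some)
    (fun f g ↦ eqToIso (by rw [dualizingIso_comp]) ≪≫
      (Fiber.nonempty_homOfIso_comp (dualizingIso j f) (dualizingIso j g)).some)
    -- All coherence laws hold because parallel 2-morphisms of the fiber are equal; the
    -- 2-isomorphisms above may therefore be arbitrary choices.
    (fun _ _ _ ↦ Subsingleton.elim _ _) (fun _ ↦ Subsingleton.elim _ _)
    (fun _ ↦ Subsingleton.elim _ _)

/-- Objects: trivialize the path, then apply `exists_tensor_iso`. Morphisms: both categories have at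
most one 2-morphism between parallel 1-morphisms, so it suffices that isomorphisms of dualizing
objects represent each 1-morphism of the fiber exactly once. -/
lemma picToFiber_isBiequivalence [MonoidalPreadditive A] [MonoidalLinear k A] :
    IsBiequivalence (picToFiber j) := by
  constructor
  · intro x
    obtain ⟨U, ⟨f⟩⟩ := Fiber.exists_hom_of x
    obtain ⟨M, N, hM, hN, ⟨e⟩, ⟨i⟩⟩ := exists_tensor_iso S U
    obtain ⟨N', rfl⟩ := exists_picObj_eq hM hN e
    obtain ⟨E⟩ := Fiber.exists_equivalence (f ≫ Fiber.homOfIso (j N' ≪≫ i))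
    -- `E` goes from `x` to the image of `N'`; its inverse is an equivalence in the required
    -- direction.
    obtain ⟨E'⟩ := Fiber.exists_equivalence E.inv
    exact ⟨N', ⟨E'⟩⟩
  · intro N N'
    have hmap (f : N ⟶ N') :
        (picToFiber j).map f = Fiber.homOfIso (dualizingIso j f) := rfl
    exact {
      faithful := ⟨fun _ ↦ Subsingleton.elim _ _⟩
      -- The 2-morphisms of the source are identities, so fullness means that 2-isomorphic images
      -- come from equal 1-morphisms.
      full := ⟨fun {f g} a ↦ by
        have h := (dualizingIso_bijective j N N').1 (Fiber.eq_of_nonempty_homOfIso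
          ⟨Fiber.isoOfHom a⟩)
        exact ⟨eqToHom h, Subsingleton.elim _ _⟩⟩
      essSurj := ⟨fun f ↦ by
        obtain ⟨e, he⟩ := Fiber.exists_homOfIso f
        obtain ⟨g, rfl⟩ := (dualizingIso_bijective j N N').2 e
        exact ⟨g, he⟩⟩ }

end

end RibbonGV

end

theorem theorem4p2 {k : Type w} [Field k] [IsAlgClosed k]
    {A : Type u} [Category.{v} A] [Abelian A] [Linear k A] [FiniteLinearCategory k A]
    [MonoidalCategory A] [MonoidalPreadditive A] [MonoidalLinear k A] [LeftExactTensor A]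
    [BraidedCategory A] [Balancing A] (S₀ : RibbonGV k A) :
    TwoGpd.IsTwoGroupoid (RibbonGV k A) ∧ TwoGpd.IsTwoGroupoid (BAUT k A) ∧
    TwoGpd.IsFibration (RibbonGV.forget k A) ∧
    ∃ E : PIC A ⥤ᵖ TwoGpd.HoFiber (RibbonGV.forget k A) BAUT.star,
      TwoGpd.IsBiequivalence E ∧
      E.obj ⟨PicardGroupoid.unit _⟩ = ⟨S₀, 𝟙 BAUT.star⟩ ∧
      (E.comp (TwoGpd.HoFiber.proj (RibbonGV.forget k A) BAUT.star)).obj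
        ⟨PicardGroupoid.unit _⟩ = S₀ := by
  obtain ⟨T, hT, hj⟩ := RibbonGV.exists_family S₀
  refine ⟨RibbonGV.isTwoGroupoid, BAUT.isTwoGroupoid, RibbonGV.forget_isFibration,
    RibbonGV.picToFiber (fun N ↦ (hj N).some), RibbonGV.picToFiber_isBiequivalence _, ?_, hT⟩
  exact congrArg RibbonGV.Fiber.of hT
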